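/- **Setting.** Let $a<b$, $\theta=(a+b)/2$, $0<\varepsilon<(b-a)/2$, $\theta_{\pm\varepsilon}=\theta\pm\varepsilon$, and let $q$ be a real function, continuous on $[a,\theta_{-\varepsilon})$, $(\theta_{-\varepsilon},\theta_{+\varepsilon})$ and $(\theta_{+\varepsilon},b]$, with finite one-sided limits at $\theta_{\pm\varepsilon}$. Let $\beta_i,\alpha_i,\alpha_i',\delta,\gamma\in\mathbb R$ $(i=1,2)$ with $|\beta_1|+|\beta_2|\neq0$, $\delta\ne0$, $\gamma\neq0$ and $\rho=\alpha_1'\alpha_2-\alpha_1\alpha_2'>0$. Consider the eigenvalue problem $$-u''+q(x)u=\lambda u\quad\text{on }[a,\theta_{-\varepsilon})\cup(\theta_{-\varepsilon},\theta_{+\varepsilon})\cup(\theta_{+\varepsilon},b],$$ $$\beta_1u(a)+\beta_2u'(a)=0,\qquad \lambda\bigl(\alpha_1'u(b)-\alpha_2'u'(b)\bigr)+\bigl(\alpha_1u(b)-\alpha_2u'(b)\bigr)=0,$$ $$u^{(k)}(\theta_{-\varepsilon}-)=\delta u^{(k)}(\theta_{-\varepsilon}+),\qquad \delta u^{(k)}(\theta_{+\varepsilon}-)=\gamma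 u^{(k)}(\theta_{+\varepsilon}+)\qquad(k=0,1).$$ For $\lambda\in\mathbb C$ let $\phi_\lambda$, with restrictions $\phi_{-\varepsilon,\lambda},\phi_{\varepsilon,\lambda},\phi_{+\varepsilon,\lambda}$ to the three subintervals (from left to right), be the solution of the equation and of the four transmission conditions with $\phi_\lambda(a)=\beta_2$, $\phi_\lambda'(a)=-\beta_1$, and let $\chi_\lambda$ be the one with $\chi_\lambda(b)=\lambda\alpha_2'+\alpha_2$, $\chi_\lambda'(b)=\lambda\alpha_1'+\alpha_1$. Let $\omega(\lambda)=\phi_\lambda\chi_\lambda'-\phi_\lambda'\chi_\lambda$ be their Wronskian on $[a,\theta_{-\varepsilon})$, where it does not depend on $x$. **Theorem.** The function $\omega$ is entire, its zeros are real and simple, they are exactly the eigenvalues of the problem, and they form a sequence $\lambda_0<\lambda_1<\lambda_2<\cdots$. Let $g\in L_2(a,b)$ and $$F(\lambda)=\int_a^{\theta_{-\varepsilon}}g\,\phi_{-\varepsilon,\lambda}\,dx+\delta^2\int_{\theta_{-\varepsilon}}^{\theta_{+\varepsilon}}g\,\phi_{\varepsilon,\lambda}\,dx+\gamma^2\int_{\theta_{+\varepsilon}}^{b}g\,\phi_{+\varepsilon,\lambda}\,dx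 .$$ Then $F$ is an entire function of exponential type $b-a$, in the sense that $|F(\lambda)|\le Ce^{(b-a)|\lambda|}$ for all $\lambda\in\mathbb C$ with a constant $C$, and more precisely $|F(s^2)|\le C'e^{(b-a)|\operatorname{Im}s|}$ for all $s\in\mathbb C$ with a constant $C'$; and for every $\lambda\in\mathbb C$ $$F(\lambda)=\sum_{n=0}^\infty F(\lambda_n)\,\frac{\omega(\lambda)}{(\lambda-\lambda_n)\,\omega'(\lambda_n)},$$ where the quotient is understood as its limit $1$ at $\lambda=\lambda_n$. The series converges absolutely at every point of $\mathbb C$ and uniformly on compact subsets of $\mathbb C$. -/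

import Mathlib

open Set Filter Topology MeasureTheory

namespace SL

/-- `u` is a (classical) solution of `-u'' + q u = lam u` on the interval with end points `c < d`:
it is `C¹` up to the end points (so that the one-sided limits of `u` and `u'` there are the values
of `u` and of `derivWithin u (Icc c d)`), and the equation holds at every interior point. -/
structure IsSolution (q : ℝ → ℝ) (lam : ℂ) (c d : ℝ) (u : ℝ → ℂ) : Prop where
  contDiffOn : ContDiffOn ℝ 1 u (Icc c d)
  eqn : ∀ x ∈ Ioo c d, ∃ u'' : ℂ, HasDerivAt (deriv u) u'' x ∧
    -u'' + (q x : ℂ) * u x = lam * u x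

/-- A linear equation `w' = A w` with continuous bounded coefficient has a global solution. -/
theorem exists_linear_ode_solution {E : Type*} [NormedAddCommGroup E] [NormedSpace ℝ E]
    [CompleteSpace E] (A : ℝ → E →L[ℝ] E) (hA : Continuous A) (K : ℝ) (hK : ∀ t, ‖A t‖ ≤ K)
    (t₀ : ℝ) (w₀ : E) :
    ∃ w : ℝ → E, w t₀ = w₀ ∧ ∀ t, HasDerivAt w (A t (w t)) t := by
  have hK0 : 0 ≤ K := (norm_nonneg _).trans (hK 0)
  let W : ℕ → ℝ → E := fun n => Nat.rec (fun _ => w₀) (fun _ w t => ∫ s in t₀..t, A s (w s)) n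
  have W0 : ∀ t, W 0 t = w₀ := fun _ => rfl
  have WS : ∀ n t, W (n + 1) t = ∫ s in t₀..t, A s (W n s) := fun _ _ => rfl
  have Wc : ∀ n, Continuous (W n) := by
    intro n
    induction n with
    | zero => exact continuous_const
    | succ n ih =>
      exact intervalIntegral.continuous_primitive
        (fun _ _ => (hA.clm_apply ih).intervalIntegrable _ _) _
  have Wd : ∀ n t, HasDerivAt (W (n + 1)) (A t (W n t)) t := fun n t =>
    intervalIntegral.integral_hasDerivAt_right ((hA.clm_apply (Wc n)).intervalIntegrable _ _)
      ((hA.clm_apply (Wc n)).stronglyMeasurableAtFilter _ _) (hA.clm_apply (Wc n)).continuousAt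
  have Wb : ∀ n t, ‖W n t‖ ≤ ‖w₀‖ * (K * |t - t₀|) ^ n / n.factorial := by
    intro n
    induction n with
    | zero => intro t; simp [W0]
    | succ n ih =>
      intro t
      rw [WS, intervalIntegral.norm_intervalIntegral_eq]
      calc ‖∫ s in uIoc t₀ t, A s (W n s)‖
          ≤ ∫ s in uIoc t₀ t, ‖w₀‖ * K ^ (n + 1) / n.factorial * |s - t₀| ^ n := by
            apply MeasureTheory.norm_integral_le_of_norm_le
              (Continuous.integrableOn_uIoc (by fun_prop))
            refine Eventually.of_forall fun s => ?_
            calc ‖A s (W n s)‖ ≤ K * (‖w₀‖ * (K * |s - t₀|) ^ n / n.factorial) :=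
                  (A s).le_of_opNorm_le_of_le (hK s) (ih s)
              _ = _ := by ring
        _ = ‖w₀‖ * (K * |t - t₀|) ^ (n + 1) / (n + 1).factorial := by
            rw [integral_const_mul, integral_pow_abs_sub_uIoc, Nat.factorial_succ]
            push_cast
            field_simp
            ring
  have hsum : ∀ t, Summable fun n => W n t := fun t => by
    refine .of_norm_bounded (g := fun n => ‖w₀‖ * (K * |t - t₀|) ^ n / n.factorial) ?_
      fun n => Wb n t
    simpa only [mul_div_assoc] using (Real.summable_pow_div_factorial (K * |t - t₀|)).mul_left ‖w₀‖
  refine ⟨fun t => ∑' n, W n t, ?_, fun t => ?_⟩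
  · change ∑' n, W n t₀ = w₀
    refine (tsum_eq_single 0 fun n hn => ?_).trans (W0 t₀)
    obtain ⟨m, rfl⟩ := Nat.exists_eq_succ_of_ne_zero hn
    simp [WS]
  · let R := |t - t₀| + 1
    have hR : 0 < R := by positivity
    have key := hasDerivAt_tsum_of_isPreconnected (𝕜 := ℝ) (g := fun n => W (n + 1))
      (g' := fun n s => A s (W n s)) (u := fun n => K * (‖w₀‖ * (K * R) ^ n / n.factorial))
      (t := Metric.ball t₀ R) (y₀ := t₀) (y := t)
      (by
        simpa only [mul_div_assoc] using
          ((Real.summable_pow_div_factorial (K * R)).mul_left ‖w₀‖).mul_left K)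
      Metric.isOpen_ball (convex_ball _ _).isPreconnected (fun n s _ => Wd n s)
      (fun n s hs => by
        have : |s - t₀| ≤ R := by rw [← Real.dist_eq]; exact (Metric.mem_ball.1 hs).le
        refine (A s).le_of_opNorm_le_of_le (hK s) ((Wb n s).trans ?_)
        gcongr)
      (Metric.mem_ball_self hR) ((summable_nat_add_iff 1).2 (hsum t₀))
      (by rw [Metric.mem_ball, Real.dist_eq]; simp [R])
    rw [← (A t).map_tsum (hsum t)] at key
    have h2 : (fun s => ∑' n, W n s) = fun s => w₀ + ∑' n, W (n + 1) s := by
      funext s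
      rw [(hsum s).tsum_eq_zero_add, W0]
    change HasDerivAt (fun s => ∑' n, W n s) (A t (∑' n, W n t)) t
    rw [h2]
    exact key.const_add w₀

/-- The initial value problem `u'' = p u` with a continuous bounded coefficient `p`, written as a
first order system for `(u, v) = (u, u')`. -/
theorem exists_second_order_solution (p : ℝ → ℂ) (hp : Continuous p) (M : ℝ)
    (hM : ∀ t, ‖p t‖ ≤ M) (t₀ : ℝ) (A B : ℂ) :
    ∃ u v : ℝ → ℂ, u t₀ = A ∧ v t₀ = B ∧ (∀ t, HasDerivAt u (v t) t) ∧
      ∀ t, HasDerivAt v (p t * u t) t := by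
  let X : (ℂ × ℂ) →L[ℝ] (ℂ × ℂ) :=
    (ContinuousLinearMap.inl ℝ ℂ ℂ).comp (ContinuousLinearMap.snd ℝ ℂ ℂ)
  let Y : (ℂ × ℂ) →L[ℂ] (ℂ × ℂ) :=
    (ContinuousLinearMap.inr ℂ ℂ ℂ).comp (ContinuousLinearMap.fst ℂ ℂ ℂ)
  let T : ℝ → (ℂ × ℂ) →L[ℝ] (ℂ × ℂ) := fun t => X + (p t • Y).restrictScalars ℝ
  have hT : Continuous T := by
    have : Continuous fun t => (p t • Y).restrictScalars ℝ :=
      (ContinuousLinearMap.restrictScalarsL ℂ (ℂ × ℂ) (ℂ × ℂ) ℝ ℝ).continuous.comp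
        (hp.smul continuous_const)
    exact continuous_const.add this
  have hTb : ∀ t, ‖T t‖ ≤ ‖X‖ + M * ‖Y‖ := fun t => by
    refine (norm_add_le _ _).trans ?_
    rw [ContinuousLinearMap.norm_restrictScalars, norm_smul]
    gcongr
    exact hM t
  obtain ⟨w, hw₀, hw⟩ := exists_linear_ode_solution T hT _ hTb t₀ (A, B)
  refine ⟨fun t => (w t).1, fun t => (w t).2, by simp [hw₀], by simp [hw₀], fun t => ?_,
    fun t => ?_⟩
  · have h := (ContinuousLinearMap.fst ℝ ℂ ℂ).hasFDerivAt.comp_hasDerivAt t (hw t)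
    simp [T, X, Y] at h
    exact h
  · have h := (ContinuousLinearMap.snd ℝ ℂ ℂ).hasFDerivAt.comp_hasDerivAt t (hw t)
    simp [T, X, Y] at h
    exact h

/-- Existence for the initial value problem: `q` is continuous on `(c, d)` with finite limits at
the end points, and the Cauchy data are given at a point `t₀` of `[c, d]`. -/
theorem exists_isSolution {q : ℝ → ℝ} {c d : ℝ} (hcd : c < d) (hq : ContinuousOn q (Ioo c d))
    (hc : ∃ l, Tendsto q (𝓝[>] c) (𝓝 l)) (hd : ∃ l, Tendsto q (𝓝[<] d) (𝓝 l))
    (lam : ℂ) {t₀ : ℝ} (ht₀ : t₀ ∈ Icc c d) (A B : ℂ) :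
    ∃ u : ℝ → ℂ, IsSolution q lam c d u ∧ u t₀ = A ∧ derivWithin u (Icc c d) t₀ = B := by
  obtain ⟨lc, hlc⟩ := hc
  obtain ⟨ld, hld⟩ := hd
  have hQ : ContinuousOn (extendFrom (Ioo c d) q) (Icc c d) :=
    continuousOn_Icc_extendFrom_Ioo hq hlc hld
  let p : ℝ → ℂ := fun x => ((extendFrom (Ioo c d) q (projIcc c d hcd.le x) : ℝ) : ℂ) - lam
  have hpc : Continuous p :=
    (Complex.continuous_ofReal.comp (hQ.comp_continuous
      (continuous_subtype_val.comp continuous_projIcc)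
      fun x => (projIcc c d hcd.le x).2)).sub continuous_const
  have hpq : ∀ x ∈ Ioo c d, p x = (q x : ℂ) - lam := fun x hx => by
    simp only [p, projIcc_of_mem hcd.le (Ioo_subset_Icc_self hx)]
    rw [extendFrom_extends hq x hx]
  obtain ⟨M, hM⟩ : ∃ M, ∀ x, ‖p x‖ ≤ M := by
    obtain ⟨M, hM⟩ := isCompact_Icc.exists_bound_of_continuousOn hQ
    refine ⟨M + ‖lam‖, fun x => (norm_sub_le _ _).trans ?_⟩
    rw [Complex.norm_real]
    gcongr
    exact hM _ (projIcc c d hcd.le x).2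
  obtain ⟨u, v, hu, hv, h1, h2⟩ := exists_second_order_solution p hpc M hM t₀ A B
  have hder : deriv u = v := funext fun t => (h1 t).deriv
  refine ⟨u, ⟨?_, fun x hx => ⟨_, hder ▸ h2 x, ?_⟩⟩, hu, ?_⟩
  · refine (contDiff_one_iff_deriv.2 ⟨fun t => (h1 t).differentiableAt, ?_⟩).contDiffOn
    rw [hder]
    exact continuous_iff_continuousAt.2 fun t => (h2 t).continuousAt
  · rw [hpq x hx]; ring
  · rw [((h1 t₀).hasDerivWithinAt).derivWithin (uniqueDiffOn_Icc hcd t₀ ht₀), hv]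

/-- The data of the boundary value problem with transmission conditions, with the standing
assumptions on them. The discontinuities are at `θ - ε` and `θ + ε` with `θ = (a + b) / 2`. -/
structure Problem where
  (a b ε : ℝ)
  q : ℝ → ℝ
  (β₁ β₂ α₁ α₂ α₁' α₂' δ γ : ℝ)
  ε_pos : 0 < ε
  ε_lt : ε < (b - a) / 2
  q_contL : ContinuousOn q (Ico a ((a + b) / 2 - ε))
  q_contM : ContinuousOn q (Ioo ((a + b) / 2 - ε) ((a + b) / 2 + ε))
  q_contR : ContinuousOn q (Ioc ((a + b) / 2 + ε) b)
  q_limL_left : ∃ l, Tendsto q (𝓝[<] ((a + b) / 2 - ε)) (𝓝 l)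
  q_limL_right : ∃ l, Tendsto q (𝓝[>] ((a + b) / 2 - ε)) (𝓝 l)
  q_limR_left : ∃ l, Tendsto q (𝓝[<] ((a + b) / 2 + ε)) (𝓝 l)
  q_limR_right : ∃ l, Tendsto q (𝓝[>] ((a + b) / 2 + ε)) (𝓝 l)
  β_ne : |β₁| + |β₂| ≠ 0
  δ_ne : δ ≠ 0
  γ_ne : γ ≠ 0
  ρ_pos : 0 < α₁' * α₂ - α₁ * α₂'

namespace Problem

noncomputable section

variable (P : Problem)

/-- The left discontinuity point `θ - ε`. -/
def θm : ℝ := (P.a + P.b) / 2 - P.ε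

/-- The right discontinuity point `θ + ε`. -/
def θp : ℝ := (P.a + P.b) / 2 + P.ε

theorem a_lt : P.a < P.θm := by
  have := P.ε_lt
  unfold θm
  linarith

theorem θm_lt : P.θm < P.θp := by
  have := P.ε_pos
  unfold θm θp
  linarith

theorem lt_b : P.θp < P.b := by
  have := P.ε_lt
  unfold θp
  linarith

theorem existsL (lam : ℂ) {t₀ : ℝ} (ht₀ : t₀ ∈ Icc P.a P.θm) (A B : ℂ) :
    ∃ u : ℝ → ℂ, IsSolution P.q lam P.a P.θm u ∧ u t₀ = A ∧
      derivWithin u (Icc P.a P.θm) t₀ = B :=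
  exists_isSolution P.a_lt (P.q_contL.mono Ioo_subset_Ico_self)
    ⟨_, ((P.q_contL P.a ⟨le_rfl, P.a_lt⟩).mono Ioo_subset_Ico_self).tendsto.mono_left
      (nhdsWithin_Ioo_eq_nhdsGT P.a_lt).ge⟩ P.q_limL_left lam ht₀ A B

theorem existsM (lam : ℂ) {t₀ : ℝ} (ht₀ : t₀ ∈ Icc P.θm P.θp) (A B : ℂ) :
    ∃ u : ℝ → ℂ, IsSolution P.q lam P.θm P.θp u ∧ u t₀ = A ∧
      derivWithin u (Icc P.θm P.θp) t₀ = B :=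
  exists_isSolution P.θm_lt P.q_contM P.q_limL_right P.q_limR_left lam ht₀ A B

theorem existsR (lam : ℂ) {t₀ : ℝ} (ht₀ : t₀ ∈ Icc P.θp P.b) (A B : ℂ) :
    ∃ u : ℝ → ℂ, IsSolution P.q lam P.θp P.b u ∧ u t₀ = A ∧
      derivWithin u (Icc P.θp P.b) t₀ = B :=
  exists_isSolution P.lt_b (P.q_contR.mono Ioo_subset_Ioc_self) P.q_limR_right
    ⟨_, ((P.q_contR P.b ⟨P.lt_b, le_rfl⟩).mono Ioo_subset_Ioc_self).tendsto.mono_left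
      (nhdsWithin_Ioo_eq_nhdsLT P.lt_b).ge⟩ lam ht₀ A B

/-- One-sided derivative on the left closed subinterval `[a, θ - ε]`. -/
def DL (u : ℝ → ℂ) (x : ℝ) : ℂ := derivWithin u (Icc P.a P.θm) x

/-- One-sided derivative on the middle closed subinterval `[θ - ε, θ + ε]`. -/
def DM (u : ℝ → ℂ) (x : ℝ) : ℂ := derivWithin u (Icc P.θm P.θp) x

/-- One-sided derivative on the right closed subinterval `[θ + ε, b]`. -/
def DR (u : ℝ → ℂ) (x : ℝ) : ℂ := derivWithin u (Icc P.θp P.b) x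

/-- `lam` is an eigenvalue: there is a nontrivial solution of the equation on the three
subintervals (with restrictions `uL`, `uM`, `uR`, extended by their limits to the end points)
which satisfies both boundary conditions and the four transmission conditions. -/
def IsEigenvalue (lam : ℂ) : Prop :=
  ∃ uL uM uR : ℝ → ℂ,
    IsSolution P.q lam P.a P.θm uL ∧ IsSolution P.q lam P.θm P.θp uM ∧
    IsSolution P.q lam P.θp P.b uR ∧
    P.β₁ * uL P.a + P.β₂ * P.DL uL P.a = 0 ∧
    lam * (P.α₁' * uR P.b - P.α₂' * P.DR uR P.b) + (P.α₁ * uR P.b - P.α₂ * P.DR uR P.b) = 0 ∧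
    uL P.θm - P.δ * uM P.θm = 0 ∧
    P.DL uL P.θm - P.δ * P.DM uM P.θm = 0 ∧
    P.δ * uM P.θp - P.γ * uR P.θp = 0 ∧
    P.δ * P.DM uM P.θp - P.γ * P.DR uR P.θp = 0 ∧
    ¬((∀ x ∈ Icc P.a P.θm, uL x = 0) ∧ (∀ x ∈ Icc P.θm P.θp, uM x = 0) ∧
      ∀ x ∈ Icc P.θp P.b, uR x = 0)

/-- The solution `φ` on `[a, θ - ε]`: `φ(a) = β₂`, `φ'(a) = -β₁`. (The initial value problem
determines it on that interval; its values elsewhere are never used. Likewise below.) -/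
def phiL (lam : ℂ) : ℝ → ℂ :=
  (P.existsL lam (left_mem_Icc.2 P.a_lt.le) P.β₂ (-P.β₁)).choose

/-- The solution `φ` on `[θ - ε, θ + ε]`. -/
def phiM (lam : ℂ) : ℝ → ℂ :=
  (P.existsM lam (left_mem_Icc.2 P.θm_lt.le) ((P.δ : ℂ)⁻¹ * P.phiL lam P.θm)
    ((P.δ : ℂ)⁻¹ * P.DL (P.phiL lam) P.θm)).choose

/-- The solution `φ` on `[θ + ε, b]`. -/
def phiR (lam : ℂ) : ℝ → ℂ :=
  (P.existsR lam (left_mem_Icc.2 P.lt_b.le) (P.δ * (P.γ : ℂ)⁻¹ * P.phiM lam P.θp)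
    (P.δ * (P.γ : ℂ)⁻¹ * P.DM (P.phiM lam) P.θp)).choose

/-- The solution `χ` on `[θ + ε, b]`: `χ(b) = lam α₂' + α₂`, `χ'(b) = lam α₁' + α₁`. -/
def chiR (lam : ℂ) : ℝ → ℂ :=
  (P.existsR lam (right_mem_Icc.2 P.lt_b.le) (lam * P.α₂' + P.α₂) (lam * P.α₁' + P.α₁)).choose

/-- The solution `χ` on `[θ - ε, θ + ε]`. -/
def chiM (lam : ℂ) : ℝ → ℂ :=
  (P.existsM lam (right_mem_Icc.2 P.θm_lt.le) (P.γ * (P.δ : ℂ)⁻¹ * P.chiR lam P.θp)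
    (P.γ * (P.δ : ℂ)⁻¹ * P.DR (P.chiR lam) P.θp)).choose

/-- The solution `χ` on `[a, θ - ε]`. -/
def chiL (lam : ℂ) : ℝ → ℂ :=
  (P.existsL lam (right_mem_Icc.2 P.a_lt.le) (P.δ * P.chiM lam P.θm)
    (P.δ * P.DM (P.chiM lam) P.θm)).choose

/-- The Wronskian `φ χ' - φ' χ` on `[a, θ - ε]`. It does not depend on the point, and is taken
at `x = a`. -/
def omega (lam : ℂ) : ℂ :=
  P.phiL lam P.a * P.DL (P.chiL lam) P.a - P.DL (P.phiL lam) P.a * P.chiL lam P.a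

/-- The transform of `g` with kernel `φ` and weights `1`, `δ²`, `γ²`. -/
def F (g : ℝ → ℂ) (lam : ℂ) : ℂ :=
  (∫ x in P.a..P.θm, g x * P.phiL lam x) +
    (P.δ : ℂ) ^ 2 * (∫ x in P.θm..P.θp, g x * P.phiM lam x) +
    (P.γ : ℂ) ^ 2 * ∫ x in P.θp..P.b, g x * P.phiR lam x

/-- The sampling function `ω(lam) / ((lam - μ) ω'(μ))` at a zero `μ` of `ω`, with its removable
singularity at `lam = μ` removed. -/
def sampling (μ lam : ℂ) : ℂ :=
  if lam = μ then 1 else P.omega lam / ((lam - μ) * deriv P.omega μ)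

end

end Problem

end SL

/-
Multiplying the three pieces of `φ` by the weights `1`, `δ`, `γ` turns the transmission conditions
into continuity, so that `φ` becomes a `C¹` solution `u` of `-u'' + q u = λ u` on `[a, b]`. Since
the right-hand boundary condition depends on `λ`, the Hilbert space is `L² ⊕ ℂ`, and
`Φ λ = (u, ρ ^ (-1/2) (α₁' u(b) - α₂' u'(b)))`. Lagrange's identity evaluates `⟪Φ w, Φ z⟫` in closed
form: `(z - conj w) ⟪Φ w, Φ z⟫ = conj (r w) ω z - conj (ω w) r z`, where `r` is a multiple of the
second component of `Φ`. At a zero of `ω` this formula shows that the zero is real and simple, that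
the corresponding vectors are orthogonal, and that `⟪Φ t, Φ z⟫ / ⟪Φ t, Φ t⟫` is the sampling
function `ω z / ((z - t) ω' t)`. If `x` is orthogonal to `Φ t` for all zeros `t` of `ω`, then
`⟪x, Φ z⟫ / ω z` is entire and `O(1 / |Im z|)`, hence zero; so the sampling series of
`F z = ⟪x, Φ z⟫` is an orthogonal expansion. There are infinitely many zeros because the `Φ z` are
linearly independent, and they are bounded below because `u'(b) / u(b)` tends to `∞` as `λ → -∞`
but would stay bounded above along zeros of `ω`.
-/

namespace SL

open scoped ComplexConjugate

section Order

theorem nonempty_orderIso_nat {α : Type*} [LinearOrder α] [Infinite α]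
    (hfin : ∀ y : α, (Iic y).Finite) : Nonempty (α ≃o ℕ) := by
  obtain ⟨x⟩ : Nonempty α := inferInstance
  obtain ⟨b, hbx, hb⟩ := (hfin x).exists_minimalFor id _ ⟨x, le_rfl⟩
  have hleast : ∀ z, b ≤ z := fun z => by
    by_contra! hz
    exact (hb (hz.le.trans hbx) hz.le).not_gt hz
  let _ : LocallyFiniteOrder α :=
    LocallyFiniteOrder.ofFiniteIcc fun x y => (hfin y).subset Icc_subset_Iic_self
  let _ : OrderBot α := { bot := b, bot_le := hleast }
  have _ : NoMaxOrder α := ⟨fun y => by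
    by_contra! hy
    exact infinite_univ ((hfin y).subset fun z _ => hy z)⟩
  let _ : SuccOrder α := LinearLocallyFiniteOrder.succOrder α
  let _ : PredOrder α := LinearLocallyFiniteOrder.predOrder α
  exact ⟨orderIsoNatOfLinearSuccPredArch⟩

theorem exists_strictMono_range_eq {α : Type*} [LinearOrder α] {Z : Set α} (hinf : Z.Infinite)
    (hfin : ∀ y, (Z ∩ Iic y).Finite) : ∃ s : ℕ → α, StrictMono s ∧ range s = Z := by
  have := hinf.to_subtype
  obtain ⟨e⟩ : Nonempty (Z ≃o ℕ) := nonempty_orderIso_nat fun y => by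
    refine .of_finite_image (f := Subtype.val) ((hfin y).subset ?_) Subtype.val_injective.injOn
    rintro _ ⟨z, hz, rfl⟩
    exact ⟨z.2, hz⟩
  refine ⟨fun n => e.symm n, fun i j hij => e.symm.strictMono hij, ?_⟩
  rw [range_comp' Subtype.val e.symm, e.symm.surjective.range_eq, image_univ, Subtype.range_coe]

end Order

section Entire

theorem norm_sq_sub_norm_sq (s : ℂ) : ‖s ^ 2 - (‖s‖ : ℂ) ^ 2‖ = 2 * ‖s‖ * |s.im| := by
  have h : s ^ 2 - (‖s‖ : ℂ) ^ 2 = s * (s - conj s) := by rw [← Complex.mul_conj']; ring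
  rw [h, norm_mul, Complex.sub_conj]
  simp only [norm_mul, Complex.norm_real, Complex.norm_I, Real.norm_eq_abs, abs_two]
  ring

theorem norm_mul_le_of_norm_mul_abs_im_le {f : ℂ → ℂ} (hf : Differentiable ℂ f) {C : ℝ}
    (hC : ∀ z, ‖f z‖ * |z.im| ≤ C) (w : ℂ) {x : ℝ} (hx : 0 < x) : ‖f w‖ * x ≤ 2 * C := by
  have hw := norm_nonneg w
  set R : ℝ := ‖w‖ + x
  have hR : 0 < R := by positivity
  have hle : ‖(w ^ 2 - (R : ℂ) ^ 2) * f w‖ ≤ 2 * R * C := by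
    refine Complex.norm_le_of_forall_mem_frontier_norm_le (U := Metric.ball 0 R)
      (f := fun z => (z ^ 2 - (R : ℂ) ^ 2) * f z) Metric.isBounded_ball
      (by fun_prop : Differentiable ℂ _).diffContOnCl (fun z hz => ?_)
      (subset_closure (mem_ball_zero_iff.2 (lt_add_of_pos_right _ hx)))
    rw [frontier_ball _ hR.ne', mem_sphere_zero_iff_norm] at hz
    calc ‖(z ^ 2 - (R : ℂ) ^ 2) * f z‖ = 2 * R * (‖f z‖ * |z.im|) := by
          rw [norm_mul, ← hz, norm_sq_sub_norm_sq]; ring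
      _ ≤ 2 * R * C := by gcongr; exact hC z
  have hge : x * R ≤ ‖w ^ 2 - (R : ℂ) ^ 2‖ := by
    have h := norm_sub_norm_le ((R : ℂ) ^ 2) (w ^ 2)
    rw [norm_sub_rev, norm_pow, norm_pow, Complex.norm_of_nonneg hR.le] at h
    nlinarith
  refine le_of_mul_le_mul_right ?_ hR
  calc ‖f w‖ * x * R = x * R * ‖f w‖ := by ring
    _ ≤ ‖w ^ 2 - (R : ℂ) ^ 2‖ * ‖f w‖ := by gcongr
    _ ≤ 2 * C * R := by rw [← norm_mul]; linarith

theorem eq_zero_of_norm_mul_abs_im_le {f : ℂ → ℂ} (hf : Differentiable ℂ f) {C : ℝ}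
    (hC : ∀ z, ‖f z‖ * |z.im| ≤ C) (w : ℂ) : f w = 0 := by
  by_contra hne
  have hpos : 0 < ‖f w‖ := norm_pos_iff.2 hne
  have h := norm_mul_le_of_norm_mul_abs_im_le hf hC w
    (x := (2 * |C| + 1) / ‖f w‖) (by positivity)
  rw [mul_div_cancel₀ _ hpos.ne'] at h
  linarith [le_abs_self C]

theorem differentiable_dslope {f : ℂ → ℂ} (hf : Differentiable ℂ f) (t : ℂ) :
    Differentiable ℂ (dslope f t) := by
  rw [← differentiableOn_univ] at hf ⊢
  exact (Complex.differentiableOn_dslope univ_mem).2 hf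

theorem exists_differentiable_eq_mul {f g : ℂ → ℂ} (hf : Differentiable ℂ f)
    (hg : Differentiable ℂ g) (hsimple : ∀ t, g t = 0 → deriv g t ≠ 0)
    (hfg : ∀ t, g t = 0 → f t = 0) : ∃ q : ℂ → ℂ, Differentiable ℂ q ∧ ∀ z, f z = g z * q z := by
  classical
  refine ⟨fun z => if g z = 0 then deriv f z / deriv g z else f z / g z, fun t => ?_, fun z => ?_⟩
  · by_cases ht : g t = 0
    · have hne : dslope g t t ≠ 0 := by rw [dslope_same]; exact hsimple t ht
      refine ((differentiable_dslope hf t t).fun_div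
        (differentiable_dslope hg t t) hne).congr_of_eventuallyEq ?_
      filter_upwards [(differentiable_dslope hg t t).continuousAt.eventually_ne hne] with z hz
      rcases eq_or_ne z t with rfl | hzt
      · simp only [ht, if_true, dslope_same]
      · have hf' : f z = (z - t) * dslope f t z := by
          rw [← smul_eq_mul, sub_smul_dslope, hfg t ht, sub_zero]
        have hg' : g z = (z - t) * dslope g t z := by
          rw [← smul_eq_mul, sub_smul_dslope, ht, sub_zero]
        rw [if_neg (hg' ▸ mul_ne_zero (sub_ne_zero.2 hzt) hz), hf', hg',
          mul_div_mul_left _ _ (sub_ne_zero.2 hzt)]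
    · refine ((hf t).fun_div (hg t) ht).congr_of_eventuallyEq ?_
      filter_upwards [(hg t).continuousAt.eventually_ne ht] with z hz
      exact if_neg hz
  · beta_reduce
    split_ifs with hz
    · rw [hfg z hz, hz, zero_mul]
    · rw [mul_div_cancel₀ _ hz]

end Entire

section Hilbert

variable {𝕜 H ι : Type*} [RCLike 𝕜] [NormedAddCommGroup H] [InnerProductSpace 𝕜 H]

theorem exists_hasSum_inner_smul [CompleteSpace H] {e : ι → H} (he : Orthonormal 𝕜 e) (x : H) :
    ∃ y, HasSum (fun i => inner 𝕜 (e i) x • e i) y ∧ ∀ i, inner 𝕜 (e i) y = inner 𝕜 (e i) x := by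
  classical
  have hsum : Summable fun i => inner 𝕜 (e i) x • e i := by
    simpa using (he.orthogonalFamily.summable_iff_norm_sq_summable
      (fun i => inner 𝕜 (e i) x)).2 (he.inner_products_summable x)
  refine ⟨_, hsum.hasSum, fun i => ((innerSL 𝕜 (e i)).hasSum hsum.hasSum).unique ?_⟩
  convert hasSum_single i fun j hj => ?_ using 1
  · simp [he.1 i]
  · simp [he.2 hj.symm]

theorem hasSumUniformlyOn_inner {α : Type*} {c : ι → H} {y : H} (hc : HasSum c y) {Φ : α → H}
    {K : Set α} {B : ℝ} (hB : ∀ z ∈ K, ‖Φ z‖ ≤ B) :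
    HasSumUniformlyOn (fun i z => inner 𝕜 (c i) (Φ z)) (fun z => inner 𝕜 y (Φ z)) K := by
  rw [hasSumUniformlyOn_iff_tendstoUniformlyOn, Metric.tendstoUniformlyOn_iff]
  intro ε hε
  filter_upwards [Metric.tendsto_nhds.1 hc (ε / (|B| + 1)) (by positivity)] with s hs z hz
  rw [dist_eq_norm] at hs
  rw [← sum_inner, dist_comm, dist_eq_norm, ← inner_sub_left]
  calc ‖inner 𝕜 (∑ i ∈ s, c i - y) (Φ z)‖ ≤ ‖∑ i ∈ s, c i - y‖ * ‖Φ z‖ := norm_inner_le_norm _ _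
    _ ≤ ‖∑ i ∈ s, c i - y‖ * (|B| + 1) := by gcongr; linarith [hB z hz, le_abs_self B]
    _ < ε / (|B| + 1) * (|B| + 1) := by gcongr
    _ = ε := div_mul_cancel₀ _ (by positivity)

end Hilbert

/-- A holomorphic family of vectors `Φ z` of a Hilbert space whose inner products satisfy a
Christoffel-Darboux formula in terms of two functions `ω` and `r`. The sampling theorem holds for
every such family; the bound on `r` is what forces the vectors at the zeros of `ω` to span. -/
structure IsKernelFamily {H : Type*} [NormedAddCommGroup H] [InnerProductSpace ℂ H]
    (Φ : ℂ → H) (ω r : ℂ → ℂ) (C : ℝ) : Prop where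
  differentiable : Differentiable ℂ Φ
  differentiable_omega : Differentiable ℂ ω
  ne_zero : ∀ z, Φ z ≠ 0
  kernel : ∀ z w, (z - conj w) * inner ℂ (Φ w) (Φ z) = conj (r w) * ω z - conj (ω w) * r z
  norm_le : ∀ z, ‖r z‖ ≤ C * ‖Φ z‖

namespace IsKernelFamily

variable {H : Type*} [NormedAddCommGroup H] [InnerProductSpace ℂ H]
  {Φ : ℂ → H} {ω r : ℂ → ℂ} {C : ℝ}

theorem im_eq_zero (h : IsKernelFamily Φ ω r C) {t : ℂ} (ht : ω t = 0) : t.im = 0 := by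
  have h1 := h.kernel t t
  rw [ht, map_zero, mul_zero, zero_mul, sub_zero, mul_eq_zero] at h1
  rcases h1 with h1 | h1
  · exact Complex.conj_eq_iff_im.1 (sub_eq_zero.1 h1).symm
  · exact absurd (inner_self_eq_zero.1 h1) (h.ne_zero t)

theorem sub_mul_inner (h : IsKernelFamily Φ ω r C) {t : ℂ} (ht : ω t = 0) (z : ℂ) :
    (z - t) * inner ℂ (Φ t) (Φ z) = conj (r t) * ω z := by
  have h1 := h.kernel z t
  rwa [ht, map_zero, zero_mul, sub_zero, Complex.conj_eq_iff_im.2 (h.im_eq_zero ht)] at h1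

theorem inner_eq_zero (h : IsKernelFamily Φ ω r C) {s t : ℂ} (hs : ω s = 0) (ht : ω t = 0)
    (hst : s ≠ t) : inner ℂ (Φ s) (Φ t) = 0 := by
  have h1 := h.sub_mul_inner hs t
  rw [ht, mul_zero] at h1
  exact (mul_eq_zero.1 h1).resolve_left (sub_ne_zero.2 hst.symm)

theorem differentiable_inner (h : IsKernelFamily Φ ω r C) (x : H) :
    Differentiable ℂ fun z => inner ℂ x (Φ z) :=
  (innerSL ℂ x).differentiable.comp h.differentiable

theorem inner_self_eq (h : IsKernelFamily Φ ω r C) {t : ℂ} (ht : ω t = 0) :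
    inner ℂ (Φ t) (Φ t) = conj (r t) * deriv ω t := by
  have h1 := ((hasDerivAt_id t).sub_const t).fun_mul (h.differentiable_inner (Φ t) t).hasDerivAt
  have h2 := (h.differentiable_omega t).hasDerivAt.const_mul (conj (r t))
  simp only [id, h.sub_mul_inner ht, sub_self, zero_mul, one_mul, add_zero] at h1
  exact h1.unique h2

theorem deriv_omega_ne_zero (h : IsKernelFamily Φ ω r C) {t : ℂ} (ht : ω t = 0) :
    deriv ω t ≠ 0 := fun h0 =>
  h.ne_zero t ((inner_self_eq_zero (𝕜 := ℂ)).1 (by rw [h.inner_self_eq ht, h0, mul_zero]))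

theorem inner_div_inner_self (h : IsKernelFamily Φ ω r C) {t : ℂ} (ht : ω t = 0) (z : ℂ) :
    inner ℂ (Φ t) (Φ z) / inner ℂ (Φ t) (Φ t) =
      if z = t then 1 else ω z / ((z - t) * deriv ω t) := by
  have h0 : inner ℂ (Φ t) (Φ t) ≠ 0 := inner_self_ne_zero.2 (h.ne_zero t)
  split_ifs with hz
  · rw [hz, div_self h0]
  · rw [div_eq_div_iff h0 (mul_ne_zero (sub_ne_zero.2 hz) (h.deriv_omega_ne_zero ht)),
      h.inner_self_eq ht]
    linear_combination deriv ω t * h.sub_mul_inner ht z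

theorem abs_im_mul_norm_le (h : IsKernelFamily Φ ω r C) (z : ℂ) :
    |z.im| * ‖Φ z‖ ≤ C * ‖ω z‖ := by
  have heq : ‖(z - conj z) * inner ℂ (Φ z) (Φ z)‖ = 2 * (|z.im| * ‖Φ z‖ * ‖Φ z‖) := by
    rw [inner_self_eq_norm_sq_to_K, Complex.sub_conj]
    simp only [norm_mul, Complex.norm_real, norm_pow, Complex.norm_I, Real.norm_eq_abs,
      Complex.coe_algebraMap, abs_norm, abs_two]
    ring
  have hle : ‖conj (r z) * ω z - conj (ω z) * r z‖ ≤ 2 * (‖r z‖ * ‖ω z‖) := by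
    refine (norm_sub_le _ _).trans_eq ?_
    simp only [norm_mul, RCLike.norm_conj]
    ring
  rw [← h.kernel z z, heq] at hle
  refine le_of_mul_le_mul_right ?_ (norm_pos_iff.2 (h.ne_zero z))
  calc |z.im| * ‖Φ z‖ * ‖Φ z‖ ≤ ‖r z‖ * ‖ω z‖ := by linarith
    _ ≤ C * ‖Φ z‖ * ‖ω z‖ := by gcongr; exact h.norm_le z
    _ = C * ‖ω z‖ * ‖Φ z‖ := by ring

/- The quotient of `⟪x, Φ z⟫` by `ω z` is entire, as the zeros of `ω` are simple, and is
`O(1 / |Im z|)`. -/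
theorem inner_eq_zero_of_forall (h : IsKernelFamily Φ ω r C) {x : H}
    (hx : ∀ t, ω t = 0 → inner ℂ x (Φ t) = 0) (z : ℂ) : inner ℂ x (Φ z) = 0 := by
  obtain ⟨q, hq, hq'⟩ := exists_differentiable_eq_mul (h.differentiable_inner x)
    h.differentiable_omega (fun _ => h.deriv_omega_ne_zero) hx
  suffices hbound : ∀ z, ‖q z‖ * |z.im| ≤ ‖x‖ * |C| by
    rw [hq', eq_zero_of_norm_mul_abs_im_le hq hbound, mul_zero]
  intro z
  by_cases hz : ω z = 0
  · rw [h.im_eq_zero hz, abs_zero, mul_zero]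
    positivity
  refine le_of_mul_le_mul_left ?_ (norm_pos_iff.2 hz)
  calc ‖ω z‖ * (‖q z‖ * |z.im|) = ‖inner ℂ x (Φ z)‖ * |z.im| := by rw [hq', norm_mul, mul_assoc]
    _ ≤ ‖x‖ * ‖Φ z‖ * |z.im| := by gcongr; exact norm_inner_le_norm _ _
    _ = ‖x‖ * (|z.im| * ‖Φ z‖) := by ring
    _ ≤ ‖x‖ * (C * ‖ω z‖) := mul_le_mul_of_nonneg_left (h.abs_im_mul_norm_le z) (norm_nonneg x)
    _ ≤ ‖x‖ * (|C| * ‖ω z‖) := by gcongr; exact le_abs_self C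
    _ = ‖ω z‖ * (‖x‖ * |C|) := by ring

theorem mem_closure_span [CompleteSpace H] (h : IsKernelFamily Φ ω r C) (z : ℂ) :
    Φ z ∈ (Submodule.span ℂ (Φ '' {t | ω t = 0})).topologicalClosure := by
  rw [← Submodule.orthogonal_orthogonal_eq_closure, Submodule.mem_orthogonal]
  refine fun x hx => h.inner_eq_zero_of_forall (fun t ht => ?_) z
  exact (Submodule.mem_orthogonal' _ _).1 hx _ (Submodule.subset_span ⟨t, ht, rfl⟩)

theorem infinite_zeros [CompleteSpace H] (h : IsKernelFamily Φ ω r C)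
    (hli : LinearIndependent ℂ Φ) : {t | ω t = 0}.Infinite := by
  intro hfin
  have : FiniteDimensional ℂ (Submodule.span ℂ (Φ '' {t | ω t = 0})) :=
    FiniteDimensional.span_of_finite ℂ (hfin.image _)
  have hmem : ∀ z, Φ z ∈ Submodule.span ℂ (Φ '' {t | ω t = 0}) := fun z => by
    have hz := h.mem_closure_span z
    rwa [(Submodule.closed_of_finiteDimensional _).submodule_topologicalClosure_eq] at hz
  have hli' : LinearIndependent ℂ fun z : ℂ =>
      (⟨Φ z, hmem z⟩ : Submodule.span ℂ (Φ '' {t | ω t = 0})) :=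
    LinearIndependent.of_comp (Submodule.subtype _) hli
  have := hli'.finite
  exact not_finite ℂ

theorem finite_zeros_inter (h : IsKernelFamily Φ ω r C) {K : Set ℝ} (hK : IsCompact K) :
    ({t : ℝ | ω t = 0} ∩ K).Finite := by
  by_contra hinf
  obtain ⟨t, -, ht⟩ := Set.Infinite.exists_accPt_of_subset_isCompact hinf hK inter_subset_right
  have hfreq : ∃ᶠ s : ℝ in 𝓝[≠] t, ω s = 0 :=
    (accPt_iff_frequently_nhdsNE.1 ht).mono fun s hs => hs.1
  have ht0 : ω t = 0 := by
    by_contra hne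
    exact hfreq.filter_mono nhdsWithin_le_nhds
      ((h.differentiable_omega.continuous.comp Complex.continuous_ofReal).continuousAt.eventually_ne
        hne)
  have hd : HasDerivAt (fun s : ℝ => ω s) (deriv ω t) t :=
    (h.differentiable_omega t).hasDerivAt.comp_ofReal
  exact hfreq (hd.eventually_ne (h.deriv_omega_ne_zero ht0))

theorem orthonormal (h : IsKernelFamily Φ ω r C) {ι : Type*} {s : ι → ℂ}
    (hs : Function.Injective s) (hz : ∀ i, ω (s i) = 0) :
    Orthonormal ℂ fun i => ((‖Φ (s i)‖ : ℂ)⁻¹) • Φ (s i) := by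
  refine ⟨fun i => norm_smul_inv_norm (h.ne_zero _), fun i j hij => ?_⟩
  simp only [inner_smul_left, inner_smul_right, h.inner_eq_zero (hz i) (hz j) (hs.ne hij),
    mul_zero]

theorem exists_hasSum [CompleteSpace H] (h : IsKernelFamily Φ ω r C) {ι : Type*} {s : ι → ℂ}
    (hs : Function.Injective s) (hZ : {t | ω t = 0} = range s) (x : H) :
    ∃ y, (∀ z, inner ℂ y (Φ z) = inner ℂ x (Φ z)) ∧
      HasSum (fun i => (inner ℂ (Φ (s i)) x / inner ℂ (Φ (s i)) (Φ (s i))) • Φ (s i)) y := by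
  obtain ⟨y, hsum, hy⟩ :=
    exists_hasSum_inner_smul (h.orthonormal hs fun i => hZ.ge ⟨i, rfl⟩) x
  refine ⟨y, fun z => sub_eq_zero.1 ?_, hsum.congr_fun fun i => ?_⟩
  · rw [← inner_sub_left]
    refine h.inner_eq_zero_of_forall (fun t ht => ?_) z
    obtain ⟨i, rfl⟩ := hZ.le ht
    have hne : (‖Φ (s i)‖ : ℂ) ≠ 0 := by exact_mod_cast norm_ne_zero_iff.2 (h.ne_zero _)
    have hi := hy i
    rw [inner_smul_left, inner_smul_left, ← sub_eq_zero, ← mul_sub, ← inner_sub_right,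
      mul_eq_zero, map_inv₀, Complex.conj_ofReal] at hi
    exact inner_eq_zero_symm.1 (hi.resolve_left (inv_ne_zero hne))
  · simp only [inner_smul_left, smul_smul, inner_self_eq_norm_sq_to_K, Complex.conj_ofReal,
      Complex.coe_algebraMap, map_inv₀]
    congr 1
    field_simp

theorem hasSumUniformlyOn [CompleteSpace H] (h : IsKernelFamily Φ ω r C) {ι : Type*} {s : ι → ℂ}
    (hs : Function.Injective s) (hZ : {t | ω t = 0} = range s) (x : H) {K : Set ℂ}
    (hK : IsCompact K) :
    HasSumUniformlyOn (fun i z => inner ℂ x (Φ (s i)) *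
      if z = s i then 1 else ω z / ((z - s i) * deriv ω (s i))) (fun z => inner ℂ x (Φ z)) K := by
  obtain ⟨y, hy, hsum⟩ := h.exists_hasSum hs hZ x
  obtain ⟨B, hB⟩ := hK.exists_bound_of_continuousOn h.differentiable.continuous.continuousOn
  have hterm : ∀ i z, (inner ℂ x (Φ (s i)) *
      if z = s i then 1 else ω z / ((z - s i) * deriv ω (s i))) =
      inner ℂ ((inner ℂ (Φ (s i)) x / inner ℂ (Φ (s i)) (Φ (s i))) • Φ (s i)) (Φ z) :=
    fun i z => by
      rw [← h.inner_div_inner_self (hZ.ge ⟨i, rfl⟩) z, inner_smul_left, map_div₀,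
        inner_conj_symm, inner_conj_symm]
      ring
  simpa only [hterm, hy] using hasSumUniformlyOn_inner (𝕜 := ℂ) hsum hB

end IsKernelFamily

section Growth

variable {f f' : ℝ → ℝ} {a b : ℝ}

theorem monotoneOn_of_hasDerivAt_nonneg_off_finset (S : Finset ℝ)
    (hf : ContinuousOn f (Icc a b)) (hd : ∀ x ∈ Ioo a b, x ∉ S → HasDerivAt f (f' x) x)
    (hf' : ∀ x ∈ Ioo a b, x ∉ S → 0 ≤ f' x) : MonotoneOn f (Icc a b) := by
  induction S using Finset.induction_on generalizing a b with
  | empty =>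
    refine monotoneOn_of_hasDerivWithinAt_nonneg (f' := f') (convex_Icc a b) hf ?_ ?_ <;>
      simp only [interior_Icc]
    · exact fun x hx => (hd x hx (Finset.notMem_empty x)).hasDerivWithinAt
    · exact fun x hx => hf' x hx (Finset.notMem_empty x)
  | insert s S _ ih =>
    have hins : ∀ x, x ≠ s → x ∉ S → x ∉ insert s S := fun x h h' => by simp [h, h']
    by_cases hs : s ∈ Ioo a b
    · have h₁ : Ioo a s ⊆ Ioo a b := Ioo_subset_Ioo_right hs.2.le
      have h₂ : Ioo s b ⊆ Ioo a b := Ioo_subset_Ioo_left hs.1.le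
      rw [← Icc_union_Icc_eq_Icc hs.1.le hs.2.le]
      exact (ih (hf.mono (Icc_subset_Icc_right hs.2.le))
        (fun x hx hxS => hd x (h₁ hx) (hins x hx.2.ne hxS))
        (fun x hx hxS => hf' x (h₁ hx) (hins x hx.2.ne hxS))).union_right
        (ih (hf.mono (Icc_subset_Icc_left hs.1.le))
        (fun x hx hxS => hd x (h₂ hx) (hins x hx.1.ne' hxS))
        (fun x hx hxS => hf' x (h₂ hx) (hins x hx.1.ne' hxS)))
        (isGreatest_Icc hs.1.le) (isLeast_Icc hs.2.le)
    · have hne : ∀ x ∈ Ioo a b, x ≠ s := fun x hx h => hs (h ▸ hx)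
      exact ih hf (fun x hx hxS => hd x hx (hins x (hne x hx) hxS))
        (fun x hx hxS => hf' x hx (hins x (hne x hx) hxS))

theorem exp_mul_le_of_mul_le_deriv_off_finset (S : Finset ℝ) {k : ℝ} (hab : a ≤ b)
    (hf : ContinuousOn f (Icc a b)) (hd : ∀ x ∈ Ioo a b, x ∉ S → HasDerivAt f (f' x) x)
    (hf' : ∀ x ∈ Ioo a b, x ∉ S → k * f x ≤ f' x) : Real.exp (k * (b - a)) * f a ≤ f b := by
  have hmono := monotoneOn_of_hasDerivAt_nonneg_off_finset S
    (f := fun x => Real.exp (-(k * (x - a))) * f x)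
    (f' := fun x => Real.exp (-(k * (x - a))) * -k * f x + Real.exp (-(k * (x - a))) * f' x)
    (by fun_prop) (fun x hx hxS => ?_) (fun x hx hxS => ?_)
    (left_mem_Icc.2 hab) (right_mem_Icc.2 hab) hab
  · simpa [Real.exp_neg, le_inv_mul_iff₀ (Real.exp_pos _)] using hmono
  · have hexp : HasDerivAt (fun x => Real.exp (-(k * (x - a))))
        (Real.exp (-(k * (x - a))) * -k) x := by
      simpa using (((hasDerivAt_id x).sub_const a).const_mul k).fun_neg.exp
    exact hexp.fun_mul (hd x hx hxS)
  · have := mul_nonneg (Real.exp_pos (-(k * (x - a)))).le (sub_nonneg.2 (hf' x hx hxS))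
    linarith

/- The functions `f' ± 2 m f` grow and decay exponentially: at `b` the second is small in
comparison with the first. -/
theorem mul_le_deriv_of_mul_le_deriv2_off_finset (S : Finset ℝ) {f'' : ℝ → ℝ} {m : ℝ} (hm : 0 < m)
    (hmab : 1 ≤ m * (b - a)) (hf : ContinuousOn f (Icc a b)) (hf' : ContinuousOn f' (Icc a b))
    (hd : ∀ x ∈ Ioo a b, x ∉ S → HasDerivAt f (f' x) x)
    (hd' : ∀ x ∈ Ioo a b, x ∉ S → HasDerivAt f' (f'' x) x)
    (hf'' : ∀ x ∈ Ioo a b, x ∉ S → (2 * m) ^ 2 * f x ≤ f'' x) (ha : |f' a| ≤ m * f a) :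
    m * f b ≤ f' b := by
  have hab : a ≤ b := by
    by_contra! h
    nlinarith
  have hgrow : ∀ c : ℝ, c ^ 2 = (2 * m) ^ 2 →
      Real.exp (c * (b - a)) * (f' a + c * f a) ≤ f' b + c * f b := fun c hc => by
    refine exp_mul_le_of_mul_le_deriv_off_finset S (f := fun x => f' x + c * f x)
      (f' := fun x => f'' x + c * f' x) hab (by fun_prop)
      (fun x hx hxS => (hd' x hx hxS).add ((hd x hx hxS).const_mul c)) fun x hx hxS => ?_
    have := hc ▸ hf'' x hx hxS
    linarith
  have hplus := hgrow (2 * m) rfl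
  have hminus := hgrow (-(2 * m)) (neg_sq _)
  rw [neg_mul (2 * m) (b - a), Real.exp_neg, inv_mul_le_iff₀ (Real.exp_pos _)] at hminus
  set X := Real.exp (2 * m * (b - a))
  have hX : 3 ≤ X := by linarith [Real.add_one_le_exp (2 * m * (b - a))]
  obtain ⟨hlow, hupp⟩ := abs_le.1 ha
  have hpos : 0 ≤ f' a + 2 * m * f a := by linarith
  have hposb : 0 ≤ f' b + 2 * m * f b := (by positivity : 0 ≤ X * _).trans hplus
  have hsq : X * (X * (2 * m * f b - f' b)) ≤ 3 * (f' b + 2 * m * f b) := by nlinarith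
  nlinarith [hsq]

end Growth

section Glue

variable {E : Type*} {f g : ℝ → E} {a m b : ℝ}

theorem continuousOn_ite_le [TopologicalSpace E] (ham : a ≤ m) (hmb : m ≤ b)
    (hf : ContinuousOn f (Icc a m)) (hg : ContinuousOn g (Icc m b)) (hfg : f m = g m) :
    ContinuousOn (fun x => if x ≤ m then f x else g x) (Icc a b) := by
  rw [← Icc_union_Icc_eq_Icc ham hmb]
  refine .union_of_isClosed (hf.congr fun x hx => if_pos hx.2) (hg.congr fun x hx => ?_)
    isClosed_Icc isClosed_Icc
  rcases hx.1.eq_or_lt with rfl | h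
  · exact (if_pos le_rfl).trans hfg
  · exact if_neg h.not_ge

theorem hasDerivAt_ite_le [NormedAddCommGroup E] [NormedSpace ℝ E] {f' g' : ℝ → E} {S : Finset ℝ}
    (hm : m ∈ S) (hf : ∀ x ∈ Ioo a m, x ∉ S → HasDerivAt f (f' x) x)
    (hg : ∀ x ∈ Ioo m b, x ∉ S → HasDerivAt g (g' x) x) {x : ℝ} (hx : x ∈ Ioo a b) (hxS : x ∉ S) :
    HasDerivAt (fun x => if x ≤ m then f x else g x) (if x ≤ m then f' x else g' x) x := by
  rcases lt_trichotomy x m with h | rfl | h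
  · rw [if_pos h.le]
    refine (hf x ⟨hx.1, h⟩ hxS).congr_of_eventuallyEq ?_
    filter_upwards [Iio_mem_nhds h] with t ht using if_pos (le_of_lt ht)
  · exact absurd hm hxS
  · rw [if_neg h.not_ge]
    refine (hg x ⟨h, hx.2⟩ hxS).congr_of_eventuallyEq ?_
    filter_upwards [Ioi_mem_nhds h] with t ht using if_neg (not_le.2 ht)

end Glue

theorem two_mul_inner_mul_add_le (u v c : ℂ) {σ : ℝ} (hσ : 0 < σ) :
    2 * inner ℝ v (c * u) + σ ^ 2 * (2 * inner ℝ u v) ≤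
      ‖(σ : ℂ) ^ 2 + c‖ / σ * (‖v‖ ^ 2 + σ ^ 2 * ‖u‖ ^ 2) := by
  have hinner : inner ℝ v (c * u) + σ ^ 2 * inner ℝ u v = inner ℝ v (((σ : ℂ) ^ 2 + c) * u) := by
    rw [real_inner_comm v u, ← real_inner_smul_right, ← inner_add_right, Complex.real_smul]
    push_cast
    ring_nf
  calc 2 * inner ℝ v (c * u) + σ ^ 2 * (2 * inner ℝ u v)
      = 2 * inner ℝ v (((σ : ℂ) ^ 2 + c) * u) := by rw [← hinner]; ring
    _ ≤ 2 * (‖v‖ * (‖(σ : ℂ) ^ 2 + c‖ * ‖u‖)) := by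
      rw [← norm_mul]
      gcongr
      exact real_inner_le_norm _ _
    _ = ‖(σ : ℂ) ^ 2 + c‖ / σ * (2 * ‖v‖ * (σ * ‖u‖)) := by field_simp
    _ ≤ ‖(σ : ℂ) ^ 2 + c‖ / σ * (‖v‖ ^ 2 + σ ^ 2 * ‖u‖ ^ 2) := by
      rw [← mul_pow]
      gcongr
      exact two_mul_le_add_sq _ _

/-- `u` is a `C¹` solution of `-u'' + q u = lam u` on `[a, b]` with derivative `v`; the equation
holds off the exceptional set `S`, at which `q` may jump. Carrying `v` along avoids one-sided
derivatives at the end points. -/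
structure IsSolutionOff (q : ℝ → ℝ) (S : Finset ℝ) (lam : ℂ) (a b : ℝ) (u v : ℝ → ℂ) : Prop where
  cont : ContinuousOn u (Icc a b)
  cont' : ContinuousOn v (Icc a b)
  hasDeriv : ∀ x ∈ Ioo a b, x ∉ S → HasDerivAt u (v x) x
  hasDeriv' : ∀ x ∈ Ioo a b, x ∉ S → HasDerivAt v ((q x - lam) * u x) x

theorem IsSolution.isSolutionOff {q : ℝ → ℝ} {lam : ℂ} {c d : ℝ} {u : ℝ → ℂ}
    (h : IsSolution q lam c d u) (hcd : c < d) (S : Finset ℝ) :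
    IsSolutionOff q S lam c d u (derivWithin u (Icc c d)) := by
  refine ⟨h.contDiffOn.continuousOn, h.contDiffOn.continuousOn_derivWithin
    (uniqueDiffOn_Icc hcd) le_rfl, fun x hx _ => ?_, fun x hx _ => ?_⟩
  · exact (h.contDiffOn.differentiableOn one_ne_zero x
      (Ioo_subset_Icc_self hx)).hasDerivWithinAt.hasDerivAt (Icc_mem_nhds hx.1 hx.2)
  · obtain ⟨w, hw, heqn⟩ := h.eqn x hx
    obtain rfl : w = (q x - lam) * u x := by linear_combination -heqn
    refine hw.congr_of_eventuallyEq ?_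
    filter_upwards [Ioo_mem_nhds hx.1 hx.2] with y hy
    exact derivWithin_of_mem_nhds (Icc_mem_nhds hy.1 hy.2)

namespace IsSolutionOff

variable {q : ℝ → ℝ} {S : Finset ℝ} {lam mu : ℂ} {a b : ℝ} {u v y z : ℝ → ℂ}

theorem mono (h : IsSolutionOff q S lam a b u v) {c d : ℝ} (hc : a ≤ c) (hd : d ≤ b) :
    IsSolutionOff q S lam c d u v :=
  ⟨h.cont.mono (Icc_subset_Icc hc hd), h.cont'.mono (Icc_subset_Icc hc hd),
    fun x hx => h.hasDeriv x (Ioo_subset_Ioo hc hd hx),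
    fun x hx => h.hasDeriv' x (Ioo_subset_Ioo hc hd hx)⟩

theorem const_mul (h : IsSolutionOff q S lam a b u v) (c : ℂ) :
    IsSolutionOff q S lam a b (fun x => c * u x) (fun x => c * v x) :=
  ⟨continuousOn_const.mul h.cont, continuousOn_const.mul h.cont',
    fun x hx hxS => (h.hasDeriv x hx hxS).const_mul c,
    fun x hx hxS => ((h.hasDeriv' x hx hxS).const_mul c).congr_deriv (by ring)⟩

theorem sub (h : IsSolutionOff q S lam a b u v) (h' : IsSolutionOff q S lam a b y z) :
    IsSolutionOff q S lam a b (fun x => u x - y x) (fun x => v x - z x) :=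
  ⟨h.cont.sub h'.cont, h.cont'.sub h'.cont',
    fun x hx hxS => (h.hasDeriv x hx hxS).sub (h'.hasDeriv x hx hxS),
    fun x hx hxS => ((h.hasDeriv' x hx hxS).sub (h'.hasDeriv' x hx hxS)).congr_deriv (by ring)⟩

theorem conjugate (h : IsSolutionOff q S lam a b u v) :
    IsSolutionOff q S (conj lam) a b (fun x => conj (u x)) (fun x => conj (v x)) := by
  have hd : ∀ {f : ℝ → ℂ} {f' : ℂ} {x : ℝ}, HasDerivAt f f' x →
      HasDerivAt (fun x => conj (f x)) (conj f') x := fun hf =>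
    Complex.conjCLE.toContinuousLinearMap.hasFDerivAt.comp_hasDerivAt _ hf
  exact ⟨Complex.continuous_conj.comp_continuousOn h.cont,
    Complex.continuous_conj.comp_continuousOn h.cont',
    fun x hx hxS => hd (h.hasDeriv x hx hxS),
    fun x hx hxS => (hd (h.hasDeriv' x hx hxS)).congr_deriv (by simp)⟩

theorem glue {m : ℝ} (ham : a ≤ m) (hmb : m ≤ b) (hm : m ∈ S) (h : IsSolutionOff q S lam a m u v)
    (h' : IsSolutionOff q S lam m b y z) (huy : u m = y m) (hvz : v m = z m) :
    IsSolutionOff q S lam a b (fun x => if x ≤ m then u x else y x)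
      (fun x => if x ≤ m then v x else z x) := by
  refine ⟨continuousOn_ite_le ham hmb h.cont h'.cont huy,
    continuousOn_ite_le ham hmb h.cont' h'.cont' hvz,
    fun x => hasDerivAt_ite_le hm h.hasDeriv h'.hasDeriv,
    fun x hx hxS => (hasDerivAt_ite_le hm h.hasDeriv' h'.hasDeriv' hx hxS).congr_deriv ?_⟩
  split_ifs <;> rfl

theorem energy_le (h : IsSolutionOff q S lam a b u v) {M σ : ℝ} (hσ : 0 < σ)
    (hq : ∀ x ∈ Ioo a b, x ∉ S → |q x| ≤ M) {x : ℝ} (hx : x ∈ Icc a b) :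
    ‖v x‖ ^ 2 + σ ^ 2 * ‖u x‖ ^ 2 ≤
      Real.exp ((‖(σ : ℂ) ^ 2 - lam‖ + M) / σ * (x - a)) * (‖v a‖ ^ 2 + σ ^ 2 * ‖u a‖ ^ 2) := by
  have h' := h.mono le_rfl hx.2
  have hu := h'.cont
  have hv := h'.cont'
  have hle := exp_mul_le_of_mul_le_deriv_off_finset S (k := (‖(σ : ℂ) ^ 2 - lam‖ + M) / σ)
    (f := fun t => -(‖v t‖ ^ 2 + σ ^ 2 * ‖u t‖ ^ 2))
    (f' := fun t => -(2 * inner ℝ (v t) ((q t - lam) * u t) + σ ^ 2 * (2 * inner ℝ (u t) (v t))))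
    hx.1 (by fun_prop) (fun t ht htS => ((h'.hasDeriv' t ht htS).norm_sq.add
      ((h'.hasDeriv t ht htS).norm_sq.const_mul (σ ^ 2))).neg) fun t ht htS => ?_
  · linarith
  · have hnorm : ‖(σ : ℂ) ^ 2 + (q t - lam)‖ ≤ ‖(σ : ℂ) ^ 2 - lam‖ + M := by
      rw [← add_sub_assoc, add_sub_right_comm]
      exact (norm_add_le _ _).trans
        (add_le_add_right (by simpa using hq t ⟨ht.1, ht.2.trans_le hx.2⟩ htS) _)
    rw [mul_neg, neg_le_neg_iff]
    exact (two_mul_inner_mul_add_le _ _ _ hσ).trans (by gcongr)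

theorem norm_sq_le_exp {s : ℂ} (h : IsSolutionOff q S (s ^ 2) a b u v) {M : ℝ}
    (hq : ∀ x ∈ Ioo a b, x ∉ S → |q x| ≤ M) (hM : 0 ≤ M) {x : ℝ} (hx : x ∈ Icc a b) :
    ‖u x‖ ^ 2 ≤ Real.exp ((1 + M + 2 * |s.im|) * (b - a)) * (‖v a‖ ^ 2 + ‖u a‖ ^ 2) := by
  set σ := max 1 ‖s‖
  have hσ : 1 ≤ σ := le_max_left _ _
  have hσ0 : 0 < σ := one_pos.trans_le hσ
  have hrate : (‖(σ : ℂ) ^ 2 - s ^ 2‖ + M) / σ ≤ 1 + M + 2 * |s.im| := by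
    rw [div_le_iff₀ hσ0]
    have hdiff : ‖(σ : ℂ) ^ 2 - s ^ 2‖ ≤ 1 + 2 * ‖s‖ * |s.im| := by
      have hreal : ‖(σ : ℂ) ^ 2 - (‖s‖ : ℂ) ^ 2‖ ≤ 1 := by
        rw [← Complex.ofReal_pow, ← Complex.ofReal_pow, ← Complex.ofReal_sub, Complex.norm_real,
          Real.norm_eq_abs, abs_le]
        rcases max_choice 1 ‖s‖ with hmax | hmax <;> simp only [σ, hmax]
        · constructor <;> nlinarith [norm_nonneg s, max_eq_left_iff.1 hmax]
        · simp
      rw [← norm_sq_sub_norm_sq, norm_sub_rev (s ^ 2)]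
      linarith [norm_sub_le_norm_sub_add_norm_sub ((σ : ℂ) ^ 2) ((‖s‖ : ℂ) ^ 2) (s ^ 2)]
    have hs : ‖s‖ * |s.im| ≤ σ * |s.im| := by gcongr; exact le_max_right _ _
    nlinarith
  have hxab : x - a ≤ b - a := sub_le_sub_right hx.2 a
  have hxa : 0 ≤ x - a := sub_nonneg.2 hx.1
  refine le_of_mul_le_mul_left ?_ (pow_pos hσ0 2)
  calc σ ^ 2 * ‖u x‖ ^ 2 ≤ ‖v x‖ ^ 2 + σ ^ 2 * ‖u x‖ ^ 2 := le_add_of_nonneg_left (sq_nonneg _)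
    _ ≤ _ := h.energy_le hσ0 hq hx
    _ ≤ Real.exp ((1 + M + 2 * |s.im|) * (b - a)) *
          (σ ^ 2 * ‖v a‖ ^ 2 + σ ^ 2 * ‖u a‖ ^ 2) := by
      gcongr
      exact le_mul_of_one_le_left (sq_nonneg _) (one_le_pow₀ hσ)
    _ = _ := by ring

theorem eq_zero (h : IsSolutionOff q S lam a b u v) {M : ℝ}
    (hq : ∀ x ∈ Ioo a b, x ∉ S → |q x| ≤ M) (hu : u a = 0) (hv : v a = 0) {x : ℝ}
    (hx : x ∈ Icc a b) : u x = 0 ∧ v x = 0 := by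
  have hle := h.energy_le one_pos hq hx
  simp only [hu, hv, norm_zero, ne_eq, OfNat.ofNat_ne_zero, not_false_eq_true, zero_pow, mul_zero,
    add_zero, one_pow, one_mul] at hle
  constructor <;> rw [← norm_eq_zero, ← sq_eq_zero_iff] <;>
    linarith [sq_nonneg ‖u x‖, sq_nonneg ‖v x‖]

theorem eqOn (h : IsSolutionOff q S lam a b u v) (h' : IsSolutionOff q S lam a b y z) {M : ℝ}
    (hq : ∀ x ∈ Ioo a b, x ∉ S → |q x| ≤ M) (hu : u a = y a) (hv : v a = z a) :
    EqOn u y (Icc a b) ∧ EqOn v z (Icc a b) := by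
  have h0 := fun x hx => (h.sub h').eq_zero hq (sub_eq_zero.2 hu) (sub_eq_zero.2 hv) (x := x) hx
  exact ⟨fun x hx => sub_eq_zero.1 (h0 x hx).1, fun x hx => sub_eq_zero.1 (h0 x hx).2⟩

theorem lagrange (hab : a ≤ b) (h : IsSolutionOff q S lam a b u v)
    (h' : IsSolutionOff q S mu a b y z) :
    (lam - mu) * ∫ x in a..b, u x * y x =
      (u b * z b - v b * y b) - (u a * z a - v a * y a) := by
  rw [← intervalIntegral.integral_const_mul]
  refine integral_eq_of_hasDerivAt_off_countable_of_le (fun x => u x * z x - v x * y x) _ hab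
    S.countable_toSet ((h.cont.mul h'.cont').sub (h.cont'.mul h'.cont)) (fun x hx => ?_)
    ((continuousOn_const.mul (h.cont.mul h'.cont)).intervalIntegrable_of_Icc hab)
  exact (((h.hasDeriv x hx.1 hx.2).mul (h'.hasDeriv' x hx.1 hx.2)).sub
    ((h.hasDeriv' x hx.1 hx.2).mul (h'.hasDeriv x hx.1 hx.2))).congr_deriv (by ring)

theorem wronskian_eq (hab : a ≤ b) (h : IsSolutionOff q S lam a b u v)
    (h' : IsSolutionOff q S lam a b y z) : u a * z a - v a * y a = u b * z b - v b * y b := by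
  have hlag := h.lagrange hab h'
  rw [sub_self, zero_mul] at hlag
  exact (sub_eq_zero.1 hlag.symm).symm

theorem mul_norm_sq_le_two_mul_inner {t m : ℝ} (h : IsSolutionOff q S t a b u v) (hm : 0 < m)
    (hmab : 1 ≤ m * (b - a)) (hq : ∀ x ∈ Ioo a b, x ∉ S → 2 * m ^ 2 ≤ q x - t)
    (ha : 2 * |inner ℝ (u a) (v a)| ≤ m * ‖u a‖ ^ 2) :
    m * ‖u b‖ ^ 2 ≤ 2 * inner ℝ (u b) (v b) := by
  have hu := h.cont
  have hv := h.cont'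
  refine mul_le_deriv_of_mul_le_deriv2_off_finset S (f := fun x => ‖u x‖ ^ 2)
    (f' := fun x => 2 * inner ℝ (u x) (v x))
    (f'' := fun x => 2 * (inner ℝ (u x) ((q x - t) * u x) + inner ℝ (v x) (v x))) hm hmab
    (by fun_prop) (continuousOn_const.mul (hu.inner hv))
    (fun x hx hxS => (h.hasDeriv x hx hxS).norm_sq)
    (fun x hx hxS => ((h.hasDeriv x hx hxS).inner ℝ (h.hasDeriv' x hx hxS)).const_mul 2)
    (fun x hx hxS => ?_) (by rwa [abs_mul, abs_two])
  have hinner : inner ℝ (u x) ((q x - t : ℂ) * u x) = (q x - t) * ‖u x‖ ^ 2 := by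
    rw [← Complex.ofReal_sub, ← Complex.real_smul, real_inner_smul_right,
      real_inner_self_eq_norm_sq]
  have hpot : 2 * m ^ 2 * ‖u x‖ ^ 2 ≤ (q x - t) * ‖u x‖ ^ 2 := by gcongr; exact hq x hx hxS
  have hvv : 0 ≤ inner ℝ (v x) (v x) := real_inner_self_nonneg
  rw [hinner]
  linarith

end IsSolutionOff

section LinearIndependence

variable {ι : Type*} {q : ℝ → ℝ} {U : Set ℝ} {mu : ι → ℂ} {u v : ι → ℝ → ℂ}

theorem eq_zero_of_hasDerivAt_of_eqOn_zero (hU : IsOpen U) {f f' : ℝ → ℂ}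
    (hf : ∀ x ∈ U, HasDerivAt f (f' x) x) (h0 : ∀ x ∈ U, f x = 0) {x : ℝ} (hx : x ∈ U) :
    f' x = 0 := by
  refine (hf x hx).unique ((hasDerivAt_const x (0 : ℂ)).congr_of_eventuallyEq ?_)
  filter_upwards [hU.mem_nhds hx] with t ht using h0 t ht

theorem sum_mul_sub_mul_eq_zero (hU : IsOpen U) (hu : ∀ i, ∀ x ∈ U, HasDerivAt (u i) (v i x) x)
    (hv : ∀ i, ∀ x ∈ U, HasDerivAt (v i) ((q x - mu i) * u i x) x) (s : Finset ι) (k : ι → ℂ)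
    (hk : ∀ x ∈ U, ∑ i ∈ s, k i * u i x = 0) (c : ℂ) {x : ℝ} (hx : x ∈ U) :
    ∑ i ∈ s, k i * (mu i - c) * u i x = 0 := by
  have h' : ∀ x ∈ U, ∑ i ∈ s, k i * v i x = 0 := fun x =>
    eq_zero_of_hasDerivAt_of_eqOn_zero hU
      (fun x hx => HasDerivAt.fun_sum fun i _ => (hu i x hx).const_mul (k i)) hk
  have h'' : ∑ i ∈ s, k i * ((q x - mu i) * u i x) = 0 :=
    eq_zero_of_hasDerivAt_of_eqOn_zero hU
      (fun x hx => HasDerivAt.fun_sum fun i _ => (hv i x hx).const_mul (k i)) h' hx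
  calc ∑ i ∈ s, k i * (mu i - c) * u i x
      = (q x - c) * ∑ i ∈ s, k i * u i x - ∑ i ∈ s, k i * ((q x - mu i) * u i x) := by
        rw [Finset.mul_sum, ← Finset.sum_sub_distrib]
        exact Finset.sum_congr rfl fun i _ => by ring
    _ = 0 := by rw [hk x hx, h'', mul_zero, sub_zero]

theorem linearIndependent_domRestrict (hmu : Function.Injective mu) (hU : IsOpen U)
    (hu : ∀ i, ∀ x ∈ U, HasDerivAt (u i) (v i x) x)
    (hv : ∀ i, ∀ x ∈ U, HasDerivAt (v i) ((q x - mu i) * u i x) x)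
    (hne : ∀ i, ∃ x ∈ U, u i x ≠ 0) : LinearIndependent ℂ fun i => U.domRestrict (u i) := by
  classical
  suffices h : ∀ (s : Finset ι) (k : ι → ℂ), (∀ x ∈ U, ∑ i ∈ s, k i * u i x = 0) →
      ∀ i ∈ s, k i = 0 by
    refine linearIndependent_iff'.2 fun s k hk => h s k fun x hx => ?_
    simpa [Finset.sum_apply] using congrFun hk ⟨x, hx⟩
  intro s
  induction s using Finset.induction_on with
  | empty => simp
  | insert j s hj ih =>
    intro k hk
    have hks : ∀ i ∈ s, k i = 0 := fun i hi => by
      have hz := ih (fun i => k i * (mu i - mu j)) (fun x hx => by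
        simpa [Finset.sum_insert hj] using sum_mul_sub_mul_eq_zero hU hu hv _ k hk (mu j) hx) i hi
      exact (mul_eq_zero.1 hz).resolve_right (sub_ne_zero.2 fun he => hj (hmu he ▸ hi))
    obtain ⟨x, hx, hxne⟩ := hne j
    have hkj := hk x hx
    rw [Finset.sum_insert hj, Finset.sum_eq_zero fun i hi => by rw [hks i hi, zero_mul],
      add_zero] at hkj
    exact Finset.forall_mem_insert _ _ _ |>.2 ⟨(mul_eq_zero.1 hkj).resolve_right hxne, hks⟩

end LinearIndependence

section Parameter

theorem differentiableAt_of_norm_slope_sub_slope_le {𝕜 E : Type*} [NontriviallyNormedField 𝕜]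
    [NormedAddCommGroup E] [NormedSpace 𝕜 E] [CompleteSpace E] {f : 𝕜 → E} {x : 𝕜} {C : ℝ}
    (h : ∀ y z, y ≠ x → z ≠ x → ‖slope f x y - slope f x z‖ ≤ C * ‖f y - f z‖) :
    DifferentiableAt 𝕜 f x := by
  have hcont : Tendsto f (𝓝[≠] x) (𝓝 (f x)) := by
    obtain ⟨z, hz⟩ := exists_ne x
    set D := ‖slope f x z‖ + |C| * ‖f x - f z‖
    have hsmall : ∀ᶠ y in 𝓝[≠] x, |C| * ‖y - x‖ < 1 / 2 := by
      refine (Tendsto.mono_left ?_ nhdsWithin_le_nhds).eventually_lt_const one_half_pos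
      exact (by fun_prop : Continuous fun y => |C| * ‖y - x‖).tendsto' _ _ (by simp)
    refine tendsto_iff_norm_sub_tendsto_zero.2 (squeeze_zero' (g := fun y => 2 * D * ‖y - x‖)
      (.of_forall fun y => norm_nonneg _) ?_ ((Continuous.tendsto' (by fun_prop) _ _
        (by simp)).mono_left nhdsWithin_le_nhds))
    filter_upwards [hsmall, self_mem_nhdsWithin] with y hy hyx
    have hslope : ‖slope f x y‖ ≤ D + |C| * ‖f y - f x‖ := by
      have hyz : ‖f y - f z‖ ≤ ‖f y - f x‖ + ‖f x - f z‖ := norm_sub_le_norm_sub_add_norm_sub ..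
      calc ‖slope f x y‖ ≤ ‖slope f x z‖ + ‖slope f x y - slope f x z‖ := norm_le_insert' _ _
        _ ≤ ‖slope f x z‖ + |C| * (‖f y - f x‖ + ‖f x - f z‖) := by
          gcongr
          exact (h y z hyx hz).trans (by gcongr; exact le_abs_self C)
        _ = _ := by ring
    have hy' : ‖f y - f x‖ = ‖y - x‖ * ‖slope f x y‖ := by
      rw [← norm_smul, sub_smul_slope, vsub_eq_sub]
    nlinarith [norm_nonneg (y - x), norm_nonneg (f y - f x)]
  have hcauchy : Cauchy (map (slope f x) (𝓝[≠] x)) := by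
    refine Metric.cauchy_iff.2 ⟨inferInstance, fun ε hε => ?_⟩
    obtain ⟨t, ht, htε⟩ := (Metric.cauchy_iff.1 hcont.cauchy_map).2 (ε / (|C| + 1)) (by positivity)
    refine ⟨_, image_mem_map (inter_mem ht self_mem_nhdsWithin), ?_⟩
    rintro _ ⟨y, ⟨hy, hyx⟩, rfl⟩ _ ⟨z, ⟨hz, hzx⟩, rfl⟩
    have hyz := htε _ hy _ hz
    rw [lt_div_iff₀ (by positivity), dist_eq_norm] at hyz
    rw [dist_eq_norm]
    nlinarith [h y z hyx hzx, le_abs_self C, norm_nonneg (f y - f z)]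
  obtain ⟨f', hf'⟩ := CompleteSpace.complete hcauchy
  exact (hasDerivAt_iff_tendsto_slope.2 hf').differentiableAt

variable {a b : ℝ} {S : Finset ℝ}

theorem norm_le_of_hasDerivAt_off_finset {u v c g : ℝ → ℂ} {K G : ℝ} (hK : 0 ≤ K) (hG : 0 ≤ G)
    (hu : ContinuousOn u (Icc a b)) (hv : ContinuousOn v (Icc a b))
    (hu' : ∀ x ∈ Ioo a b, x ∉ S → HasDerivAt u (v x) x)
    (hv' : ∀ x ∈ Ioo a b, x ∉ S → HasDerivAt v (c x * u x + g x) x)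
    (hc : ∀ x ∈ Ioo a b, x ∉ S → ‖c x‖ ≤ K) (hg : ∀ x ∈ Ioo a b, x ∉ S → ‖g x‖ ≤ G)
    (hua : u a = 0) (hva : v a = 0) {x : ℝ} (hx : x ∈ Icc a b) :
    ‖(u x, v x)‖ ≤ Real.exp ((K + 2) * (b - a)) * G := by
  have hsub : ∀ t ∈ Ioo a x, t ∈ Ioo a b := fun t ht => ⟨ht.1, ht.2.trans_le hx.2⟩
  have hgrow := exp_mul_le_of_mul_le_deriv_off_finset S (k := K + 2)
    (f := fun t => -(‖v t‖ ^ 2 + ‖u t‖ ^ 2 + G ^ 2))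
    (f' := fun t => -(2 * inner ℝ (v t) (c t * u t + g t) + 2 * inner ℝ (u t) (v t)))
    hx.1 ((((hv.norm.pow 2).add (hu.norm.pow 2)).add_const _).neg.mono
      (Icc_subset_Icc_right hx.2)) (fun t ht htS => (((hv' t (hsub t ht) htS).norm_sq.add
      (hu' t (hsub t ht) htS).norm_sq).add_const _).neg) fun t ht htS => ?_
  · simp only [hua, hva, norm_zero, ne_eq, OfNat.ofNat_ne_zero, not_false_eq_true, zero_pow,
      zero_add, mul_neg, neg_le_neg_iff] at hgrow
    have hxab : x - a ≤ b - a := sub_le_sub_right hx.2 a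
    have hexp : Real.exp ((K + 2) * (x - a)) ≤ Real.exp ((K + 2) * (b - a)) ^ 2 := by
      rw [← Real.exp_nat_mul, Real.exp_le_exp]
      push_cast
      nlinarith [hx.1]
    have hE : ‖v x‖ ^ 2 + ‖u x‖ ^ 2 ≤ (Real.exp ((K + 2) * (b - a)) * G) ^ 2 := by
      rw [mul_pow]
      nlinarith [sq_nonneg G]
    rw [Prod.norm_mk, max_le_iff]
    constructor <;> refine le_of_sq_le_sq (hE.trans' ?_) (by positivity) <;>
      linarith [sq_nonneg ‖u x‖, sq_nonneg ‖v x‖]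
  · have hcu := two_mul_inner_mul_add_le (u t) (v t) (c t) one_pos
    have hvg : 2 * inner ℝ (v t) (g t) ≤ ‖v t‖ ^ 2 + G ^ 2 := by
      have := (real_inner_le_norm (v t) (g t)).trans
        (mul_le_mul_of_nonneg_left (hg t (hsub t ht) htS) (norm_nonneg _))
      linarith [two_mul_le_add_sq ‖v t‖ G]
    have hc1 : ‖1 + c t‖ ≤ 1 + K := (norm_add_le _ _).trans (by
      rw [norm_one]
      gcongr
      exact hc t (hsub t ht) htS)
    simp only [Complex.ofReal_one, one_pow, one_mul, div_one] at hcu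
    rw [inner_add_right]
    nlinarith [sq_nonneg ‖u t‖, sq_nonneg ‖v t‖, sq_nonneg G]

namespace IsSolutionOff

variable {q : ℝ → ℝ} {M : ℝ} {A B : ℂ} {u v : ℂ → ℝ → ℂ} {w : ℂ → C(Icc a b, ℂ × ℂ)}

theorem hasDerivAt_slope (h : ∀ z, IsSolutionOff q S z a b (u z) (v z)) {z z₀ : ℂ} (hz : z ≠ z₀)
    {x : ℝ} (hx : x ∈ Ioo a b) (hxS : x ∉ S) :
    HasDerivAt (fun x => (z - z₀)⁻¹ * (u z x - u z₀ x)) ((z - z₀)⁻¹ * (v z x - v z₀ x)) x ∧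
    HasDerivAt (fun x => (z - z₀)⁻¹ * (v z x - v z₀ x))
      ((q x - z₀) * ((z - z₀)⁻¹ * (u z x - u z₀ x)) - u z x) x := by
  refine ⟨(((h z).hasDeriv x hx hxS).sub ((h z₀).hasDeriv x hx hxS)).const_mul _,
    ((((h z).hasDeriv' x hx hxS).sub ((h z₀).hasDeriv' x hx hxS)).const_mul _).congr_deriv ?_⟩
  have := sub_ne_zero.2 hz
  field_simp
  ring

/- The difference of the slopes from `z₀` to `y` and to `z` has zero initial data and solves the
equation for `z₀` with the source `u z - u y`. -/
theorem differentiable (h : ∀ z, IsSolutionOff q S z a b (u z) (v z))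
    (hq : ∀ x ∈ Ioo a b, x ∉ S → |q x| ≤ M) (hM : 0 ≤ M) (hu : ∀ z, u z a = A)
    (hv : ∀ z, v z a = B) (hw : ∀ z (x : Icc a b), w z x = (u z x, v z x)) :
    Differentiable ℂ w := by
  intro z₀
  refine differentiableAt_of_norm_slope_sub_slope_le
    (C := Real.exp ((M + ‖z₀‖ + 2) * (b - a))) fun y z hy hz => ?_
  refine (ContinuousMap.norm_le _ (by positivity)).2 fun x => ?_
  have hcu := fun z => (h z).cont
  have hcv := fun z => (h z).cont'
  have hbound := norm_le_of_hasDerivAt_off_finset (S := S) (K := M + ‖z₀‖) (G := ‖w y - w z‖)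
    (u := fun x => (y - z₀)⁻¹ * (u y x - u z₀ x) - (z - z₀)⁻¹ * (u z x - u z₀ x))
    (v := fun x => (y - z₀)⁻¹ * (v y x - v z₀ x) - (z - z₀)⁻¹ * (v z x - v z₀ x))
    (c := fun x => q x - z₀) (g := fun x => u z x - u y x) (by positivity) (norm_nonneg _)
    (by fun_prop) (by fun_prop)
    (fun x hx hxS => (hasDerivAt_slope h hy hx hxS).1.sub (hasDerivAt_slope h hz hx hxS).1)
    (fun x hx hxS => ((hasDerivAt_slope h hy hx hxS).2.sub
      (hasDerivAt_slope h hz hx hxS).2).congr_deriv (by ring))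
    (fun x hx hxS => (norm_sub_le _ _).trans (by
      gcongr
      simpa using hq x hx hxS))
    (fun x hx _ => ?_) (by simp [hu]) (by simp [hv]) x.2
  · simpa [slope, hw] using hbound
  · have := (norm_fst_le _).trans ((w y - w z).norm_coe_le_norm ⟨x, Ioo_subset_Icc_self hx⟩)
    rw [ContinuousMap.sub_apply, hw, hw, Prod.fst_sub] at this
    rwa [norm_sub_rev]

end IsSolutionOff

end Parameter

theorem isBounded_image_Ioo {E : Type*} [MetricSpace E] {f : ℝ → E} {c d : ℝ} {lc ld : E}
    (hf : ContinuousOn f (Ioo c d)) (hc : Tendsto f (𝓝[>] c) (𝓝 lc))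
    (hd : Tendsto f (𝓝[<] d) (𝓝 ld)) : Bornology.IsBounded (f '' Ioo c d) := by
  have hcont := continuousOn_Icc_extendFrom_Ioo hf hc hd
  refine (isCompact_Icc.image_of_continuousOn hcont).isBounded.subset ?_
  rintro _ ⟨x, hx, rfl⟩
  exact ⟨x, Ioo_subset_Icc_self hx, extendFrom_extends hf x hx⟩

theorem isOpenPosMeasure_comap_coe {X : Type*} [TopologicalSpace X] [MeasurableSpace X]
    {μ : Measure X} [μ.IsOpenPosMeasure] {s : Set X} (hs : MeasurableSet s)
    (hs' : s ⊆ closure (interior s)) : (μ.comap ((↑) : s → X)).IsOpenPosMeasure := by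
  refine ⟨fun U hU hne h0 => ?_⟩
  obtain ⟨V, hV, rfl⟩ := isOpen_induced_iff.1 hU
  obtain ⟨x, hx⟩ := hne
  rw [comap_subtype_coe_apply hs, Subtype.image_preimage_coe] at h0
  have hVs : (V ∩ interior s).Nonempty := mem_closure_iff.1 (hs' x.2) V hV hx
  refine ((hV.inter isOpen_interior).measure_pos μ hVs).ne' (measure_mono_null ?_ h0)
  exact fun y hy => ⟨interior_subset hy.2, hy.1⟩

theorem exists_eventually_mul_lt_mul_sq {α α' β β' : ℝ} (h : 0 < α' * β - α * β') :
    ∃ K : ℝ, ∀ᶠ t in atBot, (t * α' + α) * (t * β' + β) < K * (t * β' + β) ^ 2 := by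
  rcases eq_or_ne β' 0 with rfl | hβ'
  · rw [mul_zero, sub_zero] at h
    refine ⟨0, ?_⟩
    filter_upwards [(tendsto_id.atBot_mul_const h).eventually_lt_atBot (-(α * β))] with t ht
    rw [id] at ht
    linarith
  · set c := α' / β' * β - α
    refine ⟨α' / β' + 1, ?_⟩
    filter_upwards [(tendsto_abs_atBot_atTop.atTop_mul_const
      (abs_pos.2 hβ')).eventually_gt_atTop (|β| + |c|)] with t ht
    set B := t * β' + β
    have hB : |c| < |B| := by
      have := abs_sub B β
      rw [add_sub_cancel_right, abs_mul] at this
      linarith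
    have hA : (α' / β' + 1) * B ^ 2 - (t * α' + α) * B = |B| ^ 2 + c * B := by
      have : α' / β' * B = t * α' + α + c := by
        simp only [B, c]
        field_simp
        ring
      rw [sq_abs]
      linear_combination B * this
    have := neg_abs_le (c * B)
    rw [abs_mul] at this
    nlinarith [abs_nonneg c]

namespace Problem

variable (P : Problem)

theorem a_lt_b : P.a < P.b := P.a_lt.trans (P.θm_lt.trans P.lt_b)

theorem ofReal_δ_ne_zero : (P.δ : ℂ) ≠ 0 := Complex.ofReal_ne_zero.2 P.δ_ne

theorem ofReal_γ_ne_zero : (P.γ : ℂ) ≠ 0 := Complex.ofReal_ne_zero.2 P.γ_ne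

theorem β₁_sq_add_β₂_sq_pos : 0 < P.β₁ ^ 2 + P.β₂ ^ 2 := by
  refine lt_of_le_of_ne' (by positivity) fun h => P.β_ne ?_
  rw [add_eq_zero_iff_of_nonneg (sq_nonneg _) (sq_nonneg _), sq_eq_zero_iff,
    sq_eq_zero_iff] at h
  rw [h.1, h.2, abs_zero, add_zero]

/-- The points `θ - ε` and `θ + ε` at which `q` may jump. -/
noncomputable def jumps : Finset ℝ := {P.θm, P.θp}

theorem mem_jumps {x : ℝ} : x ∈ P.jumps ↔ x = P.θm ∨ x = P.θp := by simp [jumps]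

theorem notMem_jumps_of_lt {x : ℝ} (hx : x < P.θm) : x ∉ P.jumps := by
  simp [mem_jumps, hx.ne, (hx.trans P.θm_lt).ne]

theorem exists_abs_q_le :
    ∃ M, 0 ≤ M ∧ ∀ x ∈ Ioo P.a P.b, x ∉ P.jumps → |P.q x| ≤ M := by
  obtain ⟨l₁, hl₁⟩ := P.q_limL_left
  obtain ⟨l₂, hl₂⟩ := P.q_limL_right
  obtain ⟨l₃, hl₃⟩ := P.q_limR_left
  obtain ⟨l₄, hl₄⟩ := P.q_limR_right
  have ha := ((P.q_contL P.a ⟨le_rfl, P.a_lt⟩).mono Ioo_subset_Ico_self).tendsto.mono_left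
    (nhdsWithin_Ioo_eq_nhdsGT P.a_lt).ge
  have hb := ((P.q_contR P.b ⟨P.lt_b, le_rfl⟩).mono Ioo_subset_Ioc_self).tendsto.mono_left
    (nhdsWithin_Ioo_eq_nhdsLT P.lt_b).ge
  have hbdd := ((isBounded_image_Ioo (P.q_contL.mono Ioo_subset_Ico_self) ha hl₁).union
    (isBounded_image_Ioo P.q_contM hl₂ hl₃)).union
    (isBounded_image_Ioo (P.q_contR.mono Ioo_subset_Ioc_self) hl₄ hb)
  rw [← image_union, ← image_union] at hbdd
  obtain ⟨M, hM0, hM⟩ := hbdd.exists_pos_norm_le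
  refine ⟨M, hM0.le, fun x hx hxS => hM _ (mem_image_of_mem _ ?_)⟩
  rw [mem_jumps, not_or] at hxS
  rcases lt_or_gt_of_ne hxS.1 with h | h
  · exact .inl (.inl ⟨hx.1, h⟩)
  · rcases lt_or_gt_of_ne hxS.2 with h' | h'
    · exact .inl (.inr ⟨h, h'⟩)
    · exact .inr ⟨h', hx.2⟩

/-- The four transmission conditions for the restrictions of a function to the three
subintervals. -/
structure Transmits (uL uM uR : ℝ → ℂ) : Prop where
  left : uL P.θm = P.δ * uM P.θm
  left' : P.DL uL P.θm = P.δ * P.DM uM P.θm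
  right : P.δ * uM P.θp = P.γ * uR P.θp
  right' : P.δ * P.DM uM P.θp = P.γ * P.DR uR P.θp

/-- The function on `[a, b]` with the three given restrictions, weighted so that the transmission
conditions become continuity of the function and of its derivative. -/
noncomputable def glue (uL uM uR : ℝ → ℂ) (x : ℝ) : ℂ :=
  if x ≤ P.θm then uL x else if x ≤ P.θp then P.δ * uM x else P.γ * uR x

section Glue

variable {uL uM uR : ℝ → ℂ} {lam : ℂ} {x : ℝ}

theorem glue_of_le (hx : x ≤ P.θm) : P.glue uL uM uR x = uL x := if_pos hx

theorem glue_of_mem (hx : x ∈ Ioc P.θm P.θp) : P.glue uL uM uR x = P.δ * uM x := by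
  rw [glue, if_neg hx.1.not_ge, if_pos hx.2]

theorem glue_of_gt (hx : P.θp < x) : P.glue uL uM uR x = P.γ * uR x := by
  rw [glue, if_neg (P.θm_lt.trans hx).not_ge, if_neg hx.not_ge]

variable {P}

theorem Transmits.eq_zero_of_glue_eq_zero (h : P.Transmits uL uM uR)
    (h0 : ∀ x ∈ Icc P.a P.b, P.glue uL uM uR x = 0) :
    (∀ x ∈ Icc P.a P.θm, uL x = 0) ∧ (∀ x ∈ Icc P.θm P.θp, uM x = 0) ∧
      ∀ x ∈ Icc P.θp P.b, uR x = 0 := by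
  have hL : ∀ x ∈ Icc P.a P.θm, uL x = 0 := fun x hx =>
    (P.glue_of_le hx.2).symm.trans (h0 x ⟨hx.1, hx.2.trans (P.θm_lt.trans P.lt_b).le⟩)
  have hM : ∀ x ∈ Icc P.θm P.θp, uM x = 0 := fun x hx => by
    refine (mul_eq_zero.1 ?_).resolve_left P.ofReal_δ_ne_zero
    rcases hx.1.eq_or_lt with rfl | hlt
    · rw [← h.left, hL _ (right_mem_Icc.2 P.a_lt.le)]
    · exact (P.glue_of_mem ⟨hlt, hx.2⟩).symm.trans
        (h0 x ⟨(P.a_lt.trans hlt).le, hx.2.trans P.lt_b.le⟩)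
  refine ⟨hL, hM, fun x hx => (mul_eq_zero.1 ?_).resolve_left P.ofReal_γ_ne_zero⟩
  rcases hx.1.eq_or_lt with rfl | hlt
  · rw [← h.right, hM _ (right_mem_Icc.2 P.θm_lt.le), mul_zero]
  · exact (P.glue_of_gt hlt).symm.trans
      (h0 x ⟨(P.a_lt.trans (P.θm_lt.trans hlt)).le, hx.2⟩)

theorem Transmits.isSolutionOff_glue (h : P.Transmits uL uM uR)
    (hL : IsSolution P.q lam P.a P.θm uL) (hM : IsSolution P.q lam P.θm P.θp uM)
    (hR : IsSolution P.q lam P.θp P.b uR) :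
    IsSolutionOff P.q P.jumps lam P.a P.b (P.glue uL uM uR)
      (P.glue (P.DL uL) (P.DM uM) (P.DR uR)) := by
  have hMR := ((hM.isSolutionOff P.θm_lt P.jumps).const_mul P.δ).glue P.θm_lt.le P.lt_b.le
    (P.mem_jumps.2 (.inr rfl)) ((hR.isSolutionOff P.lt_b P.jumps).const_mul P.γ) h.right h.right'
  refine (hL.isSolutionOff P.a_lt P.jumps).glue P.a_lt.le (P.θm_lt.trans P.lt_b).le
    (P.mem_jumps.2 (.inl rfl)) hMR ?_ ?_ <;> rw [if_pos P.θm_lt.le]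
  exacts [h.left, h.left']

end Glue

section Solutions

variable (lam : ℂ)

theorem phiL_spec : IsSolution P.q lam P.a P.θm (P.phiL lam) ∧ P.phiL lam P.a = P.β₂ ∧
    P.DL (P.phiL lam) P.a = -P.β₁ :=
  (P.existsL lam (left_mem_Icc.2 P.a_lt.le) P.β₂ (-P.β₁)).choose_spec

theorem phiM_spec : IsSolution P.q lam P.θm P.θp (P.phiM lam) ∧
    P.phiM lam P.θm = (P.δ : ℂ)⁻¹ * P.phiL lam P.θm ∧
    P.DM (P.phiM lam) P.θm = (P.δ : ℂ)⁻¹ * P.DL (P.phiL lam) P.θm :=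
  (P.existsM lam (left_mem_Icc.2 P.θm_lt.le) ((P.δ : ℂ)⁻¹ * P.phiL lam P.θm)
    ((P.δ : ℂ)⁻¹ * P.DL (P.phiL lam) P.θm)).choose_spec

theorem phiR_spec : IsSolution P.q lam P.θp P.b (P.phiR lam) ∧
    P.phiR lam P.θp = P.δ * (P.γ : ℂ)⁻¹ * P.phiM lam P.θp ∧
    P.DR (P.phiR lam) P.θp = P.δ * (P.γ : ℂ)⁻¹ * P.DM (P.phiM lam) P.θp :=
  (P.existsR lam (left_mem_Icc.2 P.lt_b.le) (P.δ * (P.γ : ℂ)⁻¹ * P.phiM lam P.θp)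
    (P.δ * (P.γ : ℂ)⁻¹ * P.DM (P.phiM lam) P.θp)).choose_spec

theorem chiR_spec : IsSolution P.q lam P.θp P.b (P.chiR lam) ∧
    P.chiR lam P.b = lam * P.α₂' + P.α₂ ∧ P.DR (P.chiR lam) P.b = lam * P.α₁' + P.α₁ :=
  (P.existsR lam (right_mem_Icc.2 P.lt_b.le) (lam * P.α₂' + P.α₂)
    (lam * P.α₁' + P.α₁)).choose_spec

theorem chiM_spec : IsSolution P.q lam P.θm P.θp (P.chiM lam) ∧
    P.chiM lam P.θp = P.γ * (P.δ : ℂ)⁻¹ * P.chiR lam P.θp ∧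
    P.DM (P.chiM lam) P.θp = P.γ * (P.δ : ℂ)⁻¹ * P.DR (P.chiR lam) P.θp :=
  (P.existsM lam (right_mem_Icc.2 P.θm_lt.le) (P.γ * (P.δ : ℂ)⁻¹ * P.chiR lam P.θp)
    (P.γ * (P.δ : ℂ)⁻¹ * P.DR (P.chiR lam) P.θp)).choose_spec

theorem chiL_spec : IsSolution P.q lam P.a P.θm (P.chiL lam) ∧
    P.chiL lam P.θm = P.δ * P.chiM lam P.θm ∧
    P.DL (P.chiL lam) P.θm = P.δ * P.DM (P.chiM lam) P.θm :=
  (P.existsL lam (right_mem_Icc.2 P.a_lt.le) (P.δ * P.chiM lam P.θm)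
    (P.δ * P.DM (P.chiM lam) P.θm)).choose_spec

theorem transmits_phi : P.Transmits (P.phiL lam) (P.phiM lam) (P.phiR lam) := by
  have hδ := P.ofReal_δ_ne_zero
  have hγ := P.ofReal_γ_ne_zero
  obtain ⟨-, hM, hM'⟩ := P.phiM_spec lam
  obtain ⟨-, hR, hR'⟩ := P.phiR_spec lam
  constructor <;> simp only [hM, hM', hR, hR'] <;> field_simp

theorem transmits_chi : P.Transmits (P.chiL lam) (P.chiM lam) (P.chiR lam) := by
  have hδ := P.ofReal_δ_ne_zero
  obtain ⟨-, hM, hM'⟩ := P.chiM_spec lam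
  obtain ⟨-, hL, hL'⟩ := P.chiL_spec lam
  refine ⟨hL, hL', ?_, ?_⟩ <;> simp only [hM, hM'] <;> field_simp

/-- The solution `φ`, glued to a `C¹` function on `[a, b]`. -/
noncomputable def phi : ℝ → ℂ := P.glue (P.phiL lam) (P.phiM lam) (P.phiR lam)

/-- The derivative of the glued solution `φ`. -/
noncomputable def dphi : ℝ → ℂ :=
  P.glue (P.DL (P.phiL lam)) (P.DM (P.phiM lam)) (P.DR (P.phiR lam))

theorem isSolutionOff_phi :
    IsSolutionOff P.q P.jumps lam P.a P.b (P.phi lam) (P.dphi lam) :=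
  (P.transmits_phi lam).isSolutionOff_glue (P.phiL_spec lam).1 (P.phiM_spec lam).1
    (P.phiR_spec lam).1

theorem phi_a : P.phi lam P.a = P.β₂ := by
  rw [phi, P.glue_of_le P.a_lt.le, (P.phiL_spec lam).2.1]

theorem dphi_a : P.dphi lam P.a = -P.β₁ := by
  rw [dphi, P.glue_of_le P.a_lt.le, (P.phiL_spec lam).2.2]

theorem omega_eq : P.omega lam = P.γ * (P.phi lam P.b * (lam * P.α₁' + P.α₁) -
    P.dphi lam P.b * (lam * P.α₂' + P.α₂)) := by
  have hchi := (P.transmits_chi lam).isSolutionOff_glue (P.chiL_spec lam).1 (P.chiM_spec lam).1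
    (P.chiR_spec lam).1
  have hw := (P.isSolutionOff_phi lam).wronskian_eq P.a_lt_b.le hchi
  rw [P.glue_of_le P.a_lt.le, P.glue_of_le P.a_lt.le, P.glue_of_gt P.lt_b, P.glue_of_gt P.lt_b,
    (P.chiR_spec lam).2.1, (P.chiR_spec lam).2.2, phi_a, dphi_a] at hw
  rw [omega, (P.phiL_spec lam).2.1, (P.phiL_spec lam).2.2, hw]
  ring

theorem exists_eq_mul_phi {u v : ℝ → ℂ} (h : IsSolutionOff P.q P.jumps lam P.a P.b u v)
    (h0 : P.β₁ * u P.a + P.β₂ * v P.a = 0) :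
    ∃ c, EqOn u (fun x => c * P.phi lam x) (Icc P.a P.b) ∧
      EqOn v (fun x => c * P.dphi lam x) (Icc P.a P.b) := by
  obtain ⟨M, -, hM⟩ := P.exists_abs_q_le
  have hβ : (P.β₁ : ℂ) ^ 2 + (P.β₂ : ℂ) ^ 2 ≠ 0 := mod_cast P.β₁_sq_add_β₂_sq_pos.ne'
  refine ⟨(P.β₂ * u P.a - P.β₁ * v P.a) / ((P.β₁ : ℂ) ^ 2 + (P.β₂ : ℂ) ^ 2),
    h.eqOn ((P.isSolutionOff_phi lam).const_mul _) hM ?_ ?_⟩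
  · rw [phi_a]
    field_simp
    linear_combination P.β₁ * h0
  · rw [dphi_a]
    field_simp
    linear_combination P.β₂ * h0

theorem hasDerivAt_phi {x : ℝ} (hx : x ∈ Ioo P.a P.θm) :
    HasDerivAt (P.phi lam) (P.dphi lam x) x ∧
      HasDerivAt (P.dphi lam) ((P.q x - lam) * P.phi lam x) x := by
  have hx' : x ∈ Ioo P.a P.b := Ioo_subset_Ioo_right (P.θm_lt.trans P.lt_b).le hx
  have hxS := P.notMem_jumps_of_lt hx.2
  exact ⟨(P.isSolutionOff_phi lam).hasDeriv x hx' hxS,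
    (P.isSolutionOff_phi lam).hasDeriv' x hx' hxS⟩

theorem exists_phi_ne_zero : ∃ x ∈ Ioo P.a P.θm, P.phi lam x ≠ 0 := by
  by_contra! h
  have hd : ∀ x ∈ Ioo P.a P.θm, P.dphi lam x = 0 := fun x =>
    eq_zero_of_hasDerivAt_of_eqOn_zero isOpen_Ioo (fun x hx => (P.hasDerivAt_phi lam hx).1) h
  have hlim : ∀ {f : ℝ → ℂ}, ContinuousOn f (Icc P.a P.θm) → (∀ x ∈ Ioo P.a P.θm, f x = 0) →
      f P.a = 0 := fun hf h0 =>
    EqOn.of_subset_closure h0 hf continuousOn_const Ioo_subset_Icc_self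
      (closure_Ioo P.a_lt.ne).ge (left_mem_Icc.2 P.a_lt.le)
  have hsol := (P.isSolutionOff_phi lam).mono le_rfl (P.θm_lt.trans P.lt_b).le
  have hβ₂ := hlim hsol.cont h
  have hβ₁ := hlim hsol.cont' hd
  rw [phi_a, Complex.ofReal_eq_zero] at hβ₂
  rw [dphi_a, neg_eq_zero, Complex.ofReal_eq_zero] at hβ₁
  exact P.β_ne (by simp [hβ₁, hβ₂])

theorem exists_norm_phi_le : ∃ C, 0 ≤ C ∧ ∀ s : ℂ, ∀ x ∈ Icc P.a P.b,
    ‖P.phi (s ^ 2) x‖ ≤ C * Real.exp ((P.b - P.a) * |s.im|) := by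
  obtain ⟨M, hM0, hM⟩ := P.exists_abs_q_le
  refine ⟨√(Real.exp ((1 + M) * (P.b - P.a)) * (P.β₁ ^ 2 + P.β₂ ^ 2)), Real.sqrt_nonneg _,
    fun s x hx => le_of_sq_le_sq ?_ (by positivity)⟩
  calc ‖P.phi (s ^ 2) x‖ ^ 2
      ≤ Real.exp ((1 + M + 2 * |s.im|) * (P.b - P.a)) * (P.β₁ ^ 2 + P.β₂ ^ 2) := by
        simpa [phi_a, dphi_a] using (P.isSolutionOff_phi (s ^ 2)).norm_sq_le_exp hM hM0 hx
    _ = _ := by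
        rw [mul_pow, Real.sq_sqrt (by positivity), ← Real.exp_nat_mul, mul_right_comm,
          ← Real.exp_add]
        congr 2
        push_cast
        ring

variable {lam}

theorem omega_eq_zero_of_isEigenvalue (h : P.IsEigenvalue lam) : P.omega lam = 0 := by
  obtain ⟨uL, uM, uR, hL, hM, hR, ha, hb, h₁, h₂, h₃, h₄, hne⟩ := h
  have ht : P.Transmits uL uM uR :=
    ⟨sub_eq_zero.1 h₁, sub_eq_zero.1 h₂, sub_eq_zero.1 h₃, sub_eq_zero.1 h₄⟩
  obtain ⟨c, hc, hc'⟩ := P.exists_eq_mul_phi lam (ht.isSolutionOff_glue hL hM hR)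
    (by rwa [P.glue_of_le P.a_lt.le, P.glue_of_le P.a_lt.le])
  have hc0 : c ≠ 0 := by
    rintro rfl
    exact hne (ht.eq_zero_of_glue_eq_zero fun x hx => (hc hx).trans (zero_mul _))
  have hbmem := right_mem_Icc.2 P.a_lt_b.le
  have hu := hc hbmem
  have hv := hc' hbmem
  simp only [P.glue_of_gt P.lt_b] at hu hv
  refine (mul_eq_zero.1 ?_).resolve_left hc0
  rw [omega_eq]
  linear_combination P.γ ^ 2 * hb - P.γ * (lam * P.α₁' + P.α₁) * hu +
    P.γ * (lam * P.α₂' + P.α₂) * hv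

theorem isEigenvalue_of_omega_eq_zero (h : P.omega lam = 0) : P.IsEigenvalue lam := by
  obtain ⟨hL, ha, ha'⟩ := P.phiL_spec lam
  obtain ⟨h₁, h₂, h₃, h₄⟩ := P.transmits_phi lam
  refine ⟨P.phiL lam, P.phiM lam, P.phiR lam, hL, (P.phiM_spec lam).1, (P.phiR_spec lam).1,
    by rw [ha, ha']; ring, ?_, sub_eq_zero.2 h₁, sub_eq_zero.2 h₂, sub_eq_zero.2 h₃,
    sub_eq_zero.2 h₄, fun h0 => ?_⟩
  · rw [omega_eq, phi, dphi, P.glue_of_gt P.lt_b, P.glue_of_gt P.lt_b] at h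
    refine (mul_eq_zero.1 ?_).resolve_left (pow_ne_zero 2 P.ofReal_γ_ne_zero)
    linear_combination h
  · obtain ⟨x, hx, hne⟩ := P.exists_phi_ne_zero lam
    rw [phi, P.glue_of_le hx.2.le] at hne
    exact hne (h0.1 x (Ioo_subset_Icc_self hx))

theorem isEigenvalue_iff : P.IsEigenvalue lam ↔ P.omega lam = 0 :=
  ⟨P.omega_eq_zero_of_isEigenvalue, P.isEigenvalue_of_omega_eq_zero⟩

end Solutions

section BoundaryValue

/-- The Cauchy data `(φ, φ')` of the glued solution, as a continuous function on `[a, b]`. -/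
noncomputable def cauchyData (lam : ℂ) : C(Icc P.a P.b, ℂ × ℂ) where
  toFun x := (P.phi lam x, P.dphi lam x)
  continuous_toFun := (P.isSolutionOff_phi lam).cont.domRestrict.prodMk
    (P.isSolutionOff_phi lam).cont'.domRestrict

theorem differentiable_cauchyData : Differentiable ℂ P.cauchyData := by
  obtain ⟨M, hM0, hM⟩ := P.exists_abs_q_le
  exact IsSolutionOff.differentiable P.isSolutionOff_phi hM hM0 P.phi_a P.dphi_a fun _ _ => rfl

theorem differentiable_cauchyData_b :
    Differentiable ℂ fun lam => (P.phi lam P.b, P.dphi lam P.b) :=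
  (ContinuousMap.evalCLM ℂ ⟨P.b, right_mem_Icc.2 P.a_lt_b.le⟩ :
    C(Icc P.a P.b, ℂ × ℂ) →L[ℂ] ℂ × ℂ).differentiable.comp P.differentiable_cauchyData

theorem differentiable_phi_b : Differentiable ℂ fun lam => P.phi lam P.b :=
  P.differentiable_cauchyData_b.fst

theorem differentiable_dphi_b : Differentiable ℂ fun lam => P.dphi lam P.b :=
  P.differentiable_cauchyData_b.snd

/-- The coefficient `α₁' φ(b) - α₂' φ'(b)` of `lam` in the boundary condition at `b`. -/
noncomputable def bdry (lam : ℂ) : ℂ := P.α₁' * P.phi lam P.b - P.α₂' * P.dphi lam P.b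

theorem differentiable_bdry : Differentiable ℂ P.bdry :=
  (P.differentiable_phi_b.const_mul _).sub (P.differentiable_dphi_b.const_mul _)

theorem differentiable_omega : Differentiable ℂ P.omega := by
  have hφ := P.differentiable_phi_b
  have hφ' := P.differentiable_dphi_b
  rw [funext P.omega_eq]
  fun_prop

end BoundaryValue

section HilbertSpace

/-- Lebesgue measure on the type `[a, b]`, which is compact, so that `C[a, b]` maps to `L²`. -/
noncomputable def vol : Measure (Icc P.a P.b) := volume.comap Subtype.val

instance : IsFiniteMeasure P.vol :=
  have := IsFiniteMeasureOnCompacts.comap' volume continuous_subtype_val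
    (MeasurableEmbedding.subtype_coe (measurableSet_Icc (a := P.a) (b := P.b)))
  CompactSpace.isFiniteMeasure (μ := volume.comap Subtype.val)

instance : P.vol.IsOpenPosMeasure :=
  isOpenPosMeasure_comap_coe (μ := volume) measurableSet_Icc (closure_interior_Icc P.a_lt_b.ne).ge

theorem integral_vol (f : ℝ → ℂ) : ∫ x : Icc P.a P.b, f x ∂P.vol = ∫ x in P.a..P.b, f x := by
  rw [vol, integral_subtype_comap measurableSet_Icc, integral_Icc_eq_integral_Ioc,
    intervalIntegral.integral_of_le P.a_lt_b.le]

/-- The Hilbert space `L²(a, b) ⊕ ℂ`, in which the problem with its `lam`-dependent boundary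
condition is self-adjoint. -/
abbrev Hilb : Type := WithLp 2 (Lp ℂ 2 P.vol × ℂ)

/-- The determinant `ρ` of the boundary condition at `b`; its inverse weights the second component
of the Hilbert space. -/
def rho : ℝ := P.α₁' * P.α₂ - P.α₁ * P.α₂'

theorem rho_pos : 0 < P.rho := P.ρ_pos

/-- The glued solution `φ` as a continuous function on `[a, b]`. -/
noncomputable def phiC (lam : ℂ) : C(Icc P.a P.b, ℂ) where
  toFun x := P.phi lam x
  continuous_toFun := (P.isSolutionOff_phi lam).cont.domRestrict

theorem differentiable_phiC : Differentiable ℂ P.phiC :=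
  ((ContinuousLinearMap.fst ℂ ℂ ℂ).compLeftContinuous ℂ (Icc P.a P.b)).differentiable.comp
    P.differentiable_cauchyData

/-- The solution `φ` together with its boundary value, as a vector of `L²(a, b) ⊕ ℂ`. The
factor `ρ ^ (-1/2)` is what makes the boundary terms in Lagrange's identity cancel. -/
noncomputable def vec (lam : ℂ) : P.Hilb :=
  WithLp.toLp 2 (ContinuousMap.toLp 2 P.vol ℂ (P.phiC lam), ((√P.rho)⁻¹ : ℝ) * P.bdry lam)

theorem differentiable_vec : Differentiable ℂ P.vec := by
  have hφ : Differentiable ℂ fun lam => ContinuousMap.toLp 2 P.vol ℂ (P.phiC lam) :=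
    (ContinuousMap.toLp 2 P.vol ℂ : C(Icc P.a P.b, ℂ) →L[ℂ] Lp ℂ 2 P.vol).differentiable.comp
      P.differentiable_phiC
  exact (WithLp.prodContinuousLinearEquiv 2 ℂ (Lp ℂ 2 P.vol) ℂ).symm.differentiable.comp
    (hφ.prodMk (P.differentiable_bdry.const_mul _))

theorem inner_vec (z w : ℂ) : inner ℂ (P.vec w) (P.vec z) =
    (∫ x in P.a..P.b, P.phi z x * conj (P.phi w x)) +
      (P.rho : ℂ)⁻¹ * (P.bdry z * conj (P.bdry w)) := by
  have hρ : (P.rho : ℂ)⁻¹ = ((√P.rho)⁻¹ : ℝ) * ((√P.rho)⁻¹ : ℝ) := by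
    rw [← Complex.ofReal_mul, ← mul_inv, Real.mul_self_sqrt P.rho_pos.le, Complex.ofReal_inv]
  rw [WithLp.prod_inner_apply, ← P.integral_vol fun x => P.phi z x * conj (P.phi w x), hρ]
  refine congrArg₂ _ (ContinuousMap.inner_toLp P.vol (P.phiC w) (P.phiC z)) ?_
  rw [vec, vec, RCLike.inner_apply, map_mul, Complex.conj_ofReal]
  ring

theorem norm_bdry_le (z : ℂ) : ‖P.bdry z‖ ≤ √P.rho * ‖P.vec z‖ := by
  have hρ : 0 < √P.rho := Real.sqrt_pos.2 P.rho_pos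
  have h : ‖((√P.rho)⁻¹ : ℝ) * P.bdry z‖ ≤ ‖P.vec z‖ := WithLp.norm_snd_le _ (P.vec z)
  rwa [norm_mul, Complex.norm_real, norm_inv, Real.norm_of_nonneg hρ.le,
    inv_mul_le_iff₀ hρ] at h

theorem linearIndependent_vec : LinearIndependent ℂ P.vec := by
  have hphi : LinearIndependent ℂ fun z => (Ioo P.a P.θm).domRestrict (P.phi z) :=
    linearIndependent_domRestrict Function.injective_id isOpen_Ioo
      (fun z _ hx => (P.hasDerivAt_phi z hx).1) (fun z _ hx => (P.hasDerivAt_phi z hx).2)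
      P.exists_phi_ne_zero
  have hsub : Ioo P.a P.θm ⊆ Icc P.a P.b :=
    (Ioo_subset_Ioo_right (P.θm_lt.trans P.lt_b).le).trans Ioo_subset_Icc_self
  have hphiC : LinearIndependent ℂ P.phiC :=
    LinearIndependent.of_comp
      ((LinearMap.funLeft ℂ ℂ (inclusion hsub)) ∘ₗ ContinuousMap.coeFnLinearMap ℂ) hphi
  refine .of_comp (WithLp.fstₗ 2 ℂ (Lp ℂ 2 P.vol) ℂ) ?_
  exact hphiC.map' (ContinuousMap.toLp 2 P.vol ℂ).toLinearMap
    (LinearMap.ker_eq_bot.2 (ContinuousMap.toLp_injective P.vol))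

theorem isKernelFamily : IsKernelFamily P.vec P.omega
    (fun z => (P.γ * P.rho : ℂ)⁻¹ * P.bdry z) (‖(P.γ * P.rho : ℂ)⁻¹‖ * √P.rho) where
  differentiable := P.differentiable_vec
  differentiable_omega := P.differentiable_omega
  ne_zero := P.linearIndependent_vec.ne_zero
  norm_le z := by
    rw [norm_mul, mul_assoc]
    gcongr
    exact P.norm_bdry_le z
  kernel z w := by
    have hγ := P.ofReal_γ_ne_zero
    have hρ : (P.rho : ℂ) ≠ 0 := Complex.ofReal_ne_zero.2 P.rho_pos.ne'
    have hl := (P.isSolutionOff_phi z).lagrange P.a_lt_b.le (P.isSolutionOff_phi w).conjugate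
    simp only [phi_a, dphi_a, map_neg, Complex.conj_ofReal] at hl
    rw [inner_vec, mul_add, hl, omega_eq, omega_eq, bdry, bdry]
    simp only [map_mul, map_sub, map_add, map_inv₀, Complex.conj_ofReal]
    field_simp
    simp only [rho]
    push_cast
    ring

end HilbertSpace

section Zeros

theorem eventually_mul_norm_sq_le_inner (K : ℝ) : ∀ᶠ t : ℝ in atBot,
    K * ‖P.phi t P.b‖ ^ 2 ≤ inner ℝ (P.phi t P.b) (P.dphi t P.b) := by
  obtain ⟨M, -, hM⟩ := P.exists_abs_q_le
  have hβ : ∀ᶠ m : ℝ in atTop, 2 * |P.β₁ * P.β₂| ≤ m * P.β₂ ^ 2 := by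
    rcases eq_or_ne P.β₂ 0 with h | h
    · simp [h]
    · exact (tendsto_id.atTop_mul_const (by positivity)).eventually_ge_atTop _
  obtain ⟨m, hm0, hm, hmβ, hmK⟩ := ((eventually_gt_atTop (0 : ℝ)).and
    (((tendsto_id.atTop_mul_const (sub_pos.2 P.a_lt_b)).eventually_ge_atTop 1).and
      (hβ.and (eventually_ge_atTop (2 * K))))).exists
  filter_upwards [eventually_le_atBot (-(M + 2 * m ^ 2))] with t ht
  have hgrow := (P.isSolutionOff_phi t).mul_norm_sq_le_two_mul_inner hm0 hm
    (fun x hx hxS => by linarith [(abs_le.1 (hM x hx hxS)).1])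
    (by simpa [phi_a, dphi_a, Complex.inner, mul_comm P.β₁] using hmβ)
  nlinarith [sq_nonneg ‖P.phi t P.b‖]

theorem bdry_ne_zero {z : ℂ} (h : P.omega z = 0) : P.bdry z ≠ 0 := fun h0 => by
  have hinner := P.isKernelFamily.inner_self_eq h
  rw [h0, mul_zero, map_zero, zero_mul, inner_self_eq_zero] at hinner
  exact P.isKernelFamily.ne_zero z hinner

/- At a zero `t` of `ω`, the boundary condition makes `φ' / φ` at `b` equal to
`(t α₁' + α₁) / (t α₂' + α₂)`, which stays bounded above as `t → -∞` because `ρ > 0`, whereas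
`φ' / φ` tends to `∞`. -/
theorem eventually_omega_ne_zero : ∀ᶠ t : ℝ in atBot, P.omega t ≠ 0 := by
  obtain ⟨K, hK⟩ := exists_eventually_mul_lt_mul_sq P.ρ_pos
  filter_upwards [hK, P.eventually_mul_norm_sq_le_inner K] with t hAB hgrow h0
  have hbdry := P.bdry_ne_zero h0
  rw [omega_eq] at h0
  rw [bdry] at hbdry
  set u := P.phi t P.b
  set v := P.dphi t P.b
  set A := t * P.α₁' + P.α₁ with hA
  set B := t * P.α₂' + P.α₂ with hB
  have huv : (A : ℂ) * u = B * v := by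
    rw [hA, hB]
    push_cast
    linear_combination (mul_eq_zero.1 h0).resolve_left P.ofReal_γ_ne_zero
  have hB0 : (B : ℂ) ≠ 0 := Complex.ofReal_ne_zero.2 fun h => by simp [h] at hAB
  have hu : u ≠ 0 := fun hu => by
    have hv : v = 0 := (mul_eq_zero.1 (huv.symm.trans (by rw [hu, mul_zero]))).resolve_left hB0
    exact hbdry (by rw [hu, hv, mul_zero, mul_zero, sub_zero])
  have hinner : A * ‖u‖ ^ 2 = B * inner ℝ u v := by
    have := congrArg (inner ℝ u) huv
    simpa only [← Complex.real_smul, real_inner_smul_right, real_inner_self_eq_norm_sq] using this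
  have hlt : A * B * ‖u‖ ^ 2 < K * B ^ 2 * ‖u‖ ^ 2 := by gcongr
  have hle : B ^ 2 * (K * ‖u‖ ^ 2) ≤ B ^ 2 * inner ℝ u v := by gcongr
  linarith [congrArg (B * ·) hinner]

theorem exists_zeros : ∃ lam : ℕ → ℝ, StrictMono lam ∧
    {z : ℂ | P.omega z = 0} = range fun n => (lam n : ℂ) := by
  have hk := P.isKernelFamily
  have hreal : {z : ℂ | P.omega z = 0} = (↑) '' {t : ℝ | P.omega t = 0} := by
    ext z
    refine ⟨fun hz => ?_, by rintro ⟨t, ht, rfl⟩; exact ht⟩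
    have hre : (z.re : ℂ) = z := Complex.ext rfl (hk.im_eq_zero hz).symm
    exact ⟨z.re, (congrArg P.omega hre).trans hz, hre⟩
  obtain ⟨m, hm⟩ := eventually_atBot.1 P.eventually_omega_ne_zero
  have hinf := hk.infinite_zeros P.linearIndependent_vec
  rw [hreal] at hinf
  obtain ⟨s, hs, hsZ⟩ := exists_strictMono_range_eq (Set.Infinite.of_image _ hinf) fun y =>
    (hk.finite_zeros_inter (isCompact_Icc (a := m) (b := y))).subset fun t ht =>
      ⟨ht.1, le_of_not_ge fun h => hm t h ht.1, ht.2⟩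
  exact ⟨s, hs, by rw [hreal, ← hsZ, ← range_comp]; rfl⟩

end Zeros

section Transform

/-- The function on `[a, b]` whose integral against the glued solution `φ` is the transform `F`
of `g`. -/
noncomputable def weighted (g : ℝ → ℂ) : ℝ → ℂ := P.glue g g g

variable {P} {g : ℝ → ℂ}

theorem memLp_weighted (hg : MemLp g 2 (volume.restrict (Ioo P.a P.b))) :
    MemLp (P.weighted g) 2 (volume.restrict (Icc P.a P.b)) := by
  rw [Measure.restrict_congr_set Ioo_ae_eq_Icc] at hg
  have hmul : P.weighted g = fun x => P.glue 1 1 1 x * g x := by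
    funext x
    simp only [weighted, glue, Pi.one_apply, ite_mul, one_mul, mul_one]
  have hmeas : Measurable (P.glue 1 1 1) :=
    .ite measurableSet_Iic measurable_one (.ite measurableSet_Iic
      (measurable_one.const_mul _) (measurable_one.const_mul _))
  refine hg.of_le_mul (c := 1 + |P.δ| + |P.γ|) ?_ (.of_forall fun x => ?_)
  · rw [hmul]
    exact hmeas.aestronglyMeasurable.mul hg.1
  · rw [hmul, norm_mul]
    gcongr
    have hδ := abs_nonneg P.δ
    have hγ := abs_nonneg P.γ
    simp only [glue, Pi.one_apply]
    split_ifs <;> simp <;> linarith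

theorem integrableOn_weighted (hg : MemLp g 2 (volume.restrict (Ioo P.a P.b))) :
    IntegrableOn (P.weighted g) (Icc P.a P.b) :=
  (memLp_weighted hg).integrable one_le_two

theorem F_eq_integral (hg : MemLp g 2 (volume.restrict (Ioo P.a P.b))) (lam : ℂ) :
    P.F g lam = ∫ x in P.a..P.b, P.weighted g x * P.phi lam x := by
  have hi : ∀ {c d : ℝ}, P.a ≤ c → c ≤ d → d ≤ P.b →
      IntervalIntegrable (fun x => P.weighted g x * P.phi lam x) volume c d := fun hc hcd hd =>
    (intervalIntegrable_iff_integrableOn_Icc_of_le hcd).2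
      (((integrableOn_weighted hg).mul_continuousOn (P.isSolutionOff_phi lam).cont
        isCompact_Icc).mono_set (Icc_subset_Icc hc hd))
  have ha := P.a_lt.le
  have hm := P.θm_lt.le
  have hb := P.lt_b.le
  rw [← intervalIntegral.integral_add_adjacent_intervals (hi le_rfl (ha.trans hm) hb)
    (hi (ha.trans hm) hb le_rfl), ← intervalIntegral.integral_add_adjacent_intervals
    (hi le_rfl ha (hm.trans hb)) (hi ha hm hb), F, ← intervalIntegral.integral_const_mul,
    ← intervalIntegral.integral_const_mul]
  simp only [weighted, phi]
  congr 1
  · congr 1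
    · exact intervalIntegral.integral_congr_Ioo_of_le ha fun x hx => by
        rw [P.glue_of_le hx.2.le, P.glue_of_le hx.2.le]
    · refine intervalIntegral.integral_congr_Ioo_of_le hm fun x hx => ?_
      rw [P.glue_of_mem (Ioo_subset_Ioc_self hx), P.glue_of_mem (Ioo_subset_Ioc_self hx)]
      ring
  · refine intervalIntegral.integral_congr_Ioo_of_le hb fun x hx => ?_
    rw [P.glue_of_gt hx.1, P.glue_of_gt hx.1]
    ring

theorem exists_inner_vec_eq_F (hg : MemLp g 2 (volume.restrict (Ioo P.a P.b))) :
    ∃ x : P.Hilb, ∀ lam, inner ℂ x (P.vec lam) = P.F g lam := by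
  have hconj : MemLp (fun x : Icc P.a P.b => conj (P.weighted g x)) 2 P.vol :=
    MemLp.star ((memLp_weighted hg).comp_measurePreserving
      (measurePreserving_subtype_coe measurableSet_Icc))
  refine ⟨WithLp.toLp 2 (hconj.toLp _, 0), fun lam => ?_⟩
  rw [WithLp.prod_inner_apply, F_eq_integral hg, ← P.integral_vol, vec, inner_zero_left, add_zero,
    L2.inner_def]
  refine integral_congr_ae ?_
  filter_upwards [ContinuousMap.coeFn_toLp (p := 2) (𝕜 := ℂ) P.vol (P.phiC lam),
    hconj.coeFn_toLp] with x hx hx'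
  rw [hx, hx', RCLike.inner_apply, Complex.conj_conj, mul_comm]
  rfl

theorem exists_norm_F_sq_le (hg : MemLp g 2 (volume.restrict (Ioo P.a P.b))) :
    ∃ C, 0 ≤ C ∧ ∀ s : ℂ, ‖P.F g (s ^ 2)‖ ≤ C * Real.exp ((P.b - P.a) * |s.im|) := by
  obtain ⟨C, hC0, hC⟩ := P.exists_norm_phi_le
  have hab := P.a_lt_b.le
  have hi := (intervalIntegrable_iff_integrableOn_Icc_of_le hab).2 (integrableOn_weighted hg)
  refine ⟨(∫ x in P.a..P.b, ‖P.weighted g x‖) * C, mul_nonneg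
    (intervalIntegral.integral_nonneg hab fun x _ => norm_nonneg _) hC0, fun s => ?_⟩
  rw [F_eq_integral hg, mul_assoc, ← intervalIntegral.integral_mul_const]
  refine intervalIntegral.norm_integral_le_of_norm_le hab (.of_forall fun x hx => ?_)
    (hi.norm.mul_const _)
  rw [norm_mul]
  gcongr
  exact hC s x (Ioc_subset_Icc_self hx)

theorem exists_norm_F_le (hg : MemLp g 2 (volume.restrict (Ioo P.a P.b))) :
    ∃ C, ∀ z : ℂ, ‖P.F g z‖ ≤ C * Real.exp ((P.b - P.a) * ‖z‖) := by
  obtain ⟨C, hC0, hC⟩ := exists_norm_F_sq_le hg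
  have hab : 0 ≤ P.b - P.a := sub_nonneg.2 P.a_lt_b.le
  refine ⟨C * Real.exp (P.b - P.a), fun z => ?_⟩
  obtain ⟨s, rfl⟩ := IsAlgClosed.exists_pow_nat_eq z two_pos
  have him : |s.im| ≤ 1 + ‖s‖ ^ 2 := by
    nlinarith [sq_nonneg (‖s‖ - 1), Complex.abs_im_le_norm s]
  calc ‖P.F g (s ^ 2)‖ ≤ C * Real.exp ((P.b - P.a) * |s.im|) := hC s
    _ ≤ C * Real.exp ((P.b - P.a) * (1 + ‖s‖ ^ 2)) := by gcongr
    _ = C * Real.exp (P.b - P.a) * Real.exp ((P.b - P.a) * ‖s ^ 2‖) := by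
      rw [mul_assoc, ← Real.exp_add, norm_pow, mul_add, mul_one]

end Transform

end Problem

end SL

theorem theorem1 (P : SL.Problem) :
    Differentiable ℂ P.omega ∧
    ∃ lam : ℕ → ℝ, StrictMono lam ∧
      {z : ℂ | P.IsEigenvalue z} = Set.range (fun n => (lam n : ℂ)) ∧
      {z : ℂ | P.omega z = 0} = Set.range (fun n => (lam n : ℂ)) ∧
      (∀ n, deriv P.omega (lam n) ≠ 0) ∧
      ∀ g : ℝ → ℂ, MemLp g 2 (volume.restrict (Set.Ioo P.a P.b)) →
        Differentiable ℂ (P.F g) ∧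
        (∃ C : ℝ, ∀ z : ℂ, ‖P.F g z‖ ≤ C * Real.exp ((P.b - P.a) * ‖z‖)) ∧
        (∃ C : ℝ, ∀ s : ℂ, ‖P.F g (s ^ 2)‖ ≤ C * Real.exp ((P.b - P.a) * |s.im|)) ∧
        (∀ z : ℂ, Summable fun n => ‖P.F g (lam n) * P.sampling (lam n) z‖) ∧
        (∀ z : ℂ, HasSum (fun n => P.F g (lam n) * P.sampling (lam n) z) (P.F g z)) ∧
        ∀ K : Set ℂ, IsCompact K →
          TendstoUniformlyOn
            (fun N z => ∑ n ∈ Finset.range N, P.F g (lam n) * P.sampling (lam n) z)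
            (P.F g) atTop K := by
  have hk := P.isKernelFamily
  obtain ⟨lam, hlam, hZ⟩ := P.exists_zeros
  refine ⟨P.differentiable_omega, lam, hlam, (Set.ext fun _ => P.isEigenvalue_iff).trans hZ, hZ,
    fun n => hk.deriv_omega_ne_zero (hZ.ge ⟨n, rfl⟩), fun g hg => ?_⟩
  obtain ⟨x, hx⟩ := SL.Problem.exists_inner_vec_eq_F hg
  have hsum : ∀ K : Set ℂ, IsCompact K →
      HasSumUniformlyOn (fun n z => P.F g (lam n) * P.sampling (lam n) z) (P.F g) K :=
    fun K hK => by
      simpa only [SL.Problem.sampling, hx] using hk.hasSumUniformlyOn (s := fun n => (lam n : ℂ))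
        (Complex.ofReal_injective.comp hlam.injective) hZ x hK
  have hsum_at : ∀ z, HasSum (fun n => P.F g (lam n) * P.sampling (lam n) z) (P.F g z) :=
    fun z => (hsum {z} isCompact_singleton).hasSum (Set.mem_singleton z)
  refine ⟨?_, SL.Problem.exists_norm_F_le hg, (SL.Problem.exists_norm_F_sq_le hg).imp
    fun _ => And.right, fun z => (hsum_at z).summable.norm, hsum_at, fun K hK =>
      (hsum K hK).tendstoUniformlyOn_finsetRange⟩
  simpa only [hx] using hk.differentiable_inner x
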